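/- For $\nu,x\in\mathbb C$ let $D_\nu(x)$ be the parabolic cylinder function, i.e. the solution of $-y''+\left(\frac{x^2}{4}-\frac12\right)y=\nu y$ with $D_\nu(0)=\frac{2^{\nu/2}\sqrt\pi}{\Gamma\left(\frac{1-\nu}{2}\right)}$ and $D_\nu'(0)=-\frac{2^{(\nu+1)/2}\sqrt\pi}{\Gamma\left(-\frac{\nu}{2}\right)}$, where $1/\Gamma$ denotes the entire reciprocal Gamma function. For $b>0$ and $z\in\mathbb C$ let $$L_{z,b}=-\frac{d^2}{dx^2}+\left(\frac{x^2}{4}-\frac12\right)+z\left[\delta(x-b)-\delta(x+b)\right]$$ be the operator on $L^2(\mathbb R)$ associated with the form $$t_{z,b}(f,g)=\langle f',g'\rangle+\tfrac14\langle xf,xg\rangle-\tfrac12\langle f,g\rangle+z\left(f(b)\overline{g(b)}-f(-b)\overline{g(-b)}\right)$$ with form domain $\{f\in H^1(\mathbb R): xf\in L^2(\mathbb R)\}$, where $\langle f,g\rangle=\int_{\mathbb R} f\overline g$. That is, $u$ lies in the domain of $L_{z,b}$ and $L_{z,b}u=h$ if and only if $u$ lies in the form domain, $h\in L^2(\mathbb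 R)$, and $t_{z,b}(u,g)=\langle h,g\rangle$ for all $g$ in the form domain. Fix $b>0$, let $n\in\mathbb N$ satisfy $D_n(b)=0$, and let $\rho>0$. Then there is a constant $\delta>0$ (depending on $b$, $n$ and $\rho$) such that for every real $r>1/\delta$ the operator $L_{ir,b}$ has two distinct non-real eigenvalues $\nu$ with $|\nu-n|<\rho$. -/

import Mathlib

open MeasureTheory ComplexConjugate
open scoped ContDiff

noncomputable section

/-- The even solution of `-y'' + (x^2/4 - 1/2) y = ν y` with `y(0) = 1`, `y'(0) = 0`:
`e^{-x²/4} [1 + (-ν) x²/2! + (-ν)(-ν+2) x⁴/4! + ⋯]`. -/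
def weberEven (ν x : ℂ) : ℂ :=
  Complex.exp (-x ^ 2 / 4) *
    ∑' k : ℕ, (∏ j ∈ Finset.range k, (-ν + 2 * (j : ℂ))) * x ^ (2 * k) /
      (Nat.factorial (2 * k) : ℂ)

/-- The odd solution of `-y'' + (x^2/4 - 1/2) y = ν y` with `y(0) = 0`, `y'(0) = 1`:
`e^{-x²/4} [x + (-ν+1) x³/3! + (-ν+1)(-ν+3) x⁵/5! + ⋯]`. -/
def weberOdd (ν x : ℂ) : ℂ :=
  Complex.exp (-x ^ 2 / 4) *
    ∑' k : ℕ, (∏ j ∈ Finset.range k, (-ν + 1 + 2 * (j : ℂ))) * x ^ (2 * k + 1) /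
      (Nat.factorial (2 * k + 1) : ℂ)

/-- The parabolic cylinder function `D_ν(x)`: the solution of the Weber equation with
`D_ν(0) = 2^{ν/2} √π / Γ((1-ν)/2)` and `D_ν'(0) = -2^{(ν+1)/2} √π / Γ(-ν/2)`.
`Complex.Gamma` takes the value `0` at its poles, so `(Complex.Gamma s)⁻¹` is the entire
function `1/Γ(s)` for every `s`. -/
def parabolicCylinderD (ν x : ℂ) : ℂ :=
  (2 : ℂ) ^ (ν / 2) * (Real.sqrt Real.pi : ℂ) * (Complex.Gamma (-ν / 2 + 1 / 2))⁻¹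
      * weberEven ν x
    - (2 : ℂ) ^ ((ν + 1) / 2) * (Real.sqrt Real.pi : ℂ) * (Complex.Gamma (-ν / 2))⁻¹
      * weberOdd ν x

/-- `f'` is the weak derivative of `f` on the real line (tested against `C_c^∞`). -/
def HasWeakDerivative (f f' : ℝ → ℂ) : Prop :=
  ∀ φ : ℝ → ℝ, ContDiff ℝ ∞ φ → HasCompactSupport φ →
    ∫ x, deriv φ x • f x = - ∫ x, φ x • f' x

/-- The form domain `{f ∈ H¹(ℝ) : x f(x) ∈ L²(ℝ)}`. An element of `H¹(ℝ)` is given by its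
(unique) continuous representative, together with its (a.e. unique) weak derivative. -/
structure PCFormDomain where
  toFun : ℝ → ℂ
  wderiv : ℝ → ℂ
  continuous_toFun : Continuous toFun
  hasWeakDerivative : HasWeakDerivative toFun wderiv
  memLp_toFun : MemLp toFun 2 volume
  memLp_wderiv : MemLp wderiv 2 volume
  memLp_mul : MemLp (fun x : ℝ => (x : ℂ) * toFun x) 2 volume

/-- The quadratic (sesquilinear) form
`⟨f', g'⟩ + ¼ ⟨x f, x g⟩ - ½ ⟨f, g⟩ + z (f(b) conj g(b) - f(-b) conj g(-b))`,
where `⟨f, g⟩ = ∫ f conj g`. -/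
def pcForm (z : ℂ) (b : ℝ) (f g : PCFormDomain) : ℂ :=
  (∫ x, f.wderiv x * conj (g.wderiv x))
    + 1 / 4 * (∫ x : ℝ, ((x : ℂ) * f.toFun x) * conj ((x : ℂ) * g.toFun x))
    - 1 / 2 * (∫ x, f.toFun x * conj (g.toFun x))
    + z * (f.toFun b * conj (g.toFun b) - f.toFun (-b) * conj (g.toFun (-b)))

lemma HasWeakDerivative.ae_zero {f' : ℝ → ℂ} (h : HasWeakDerivative (fun _ => 0) f')
    (hf' : MemLp f' 2 volume) : f' =ᵐ[volume] 0 := by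
  refine ae_eq_zero_of_integral_contDiff_smul_eq_zero
    (hf'.locallyIntegrable (by norm_num)) fun φ hφ hc => ?_
  have := h φ hφ hc
  simpa using this.symm

/-- Smooth compactly supported functions lie in the form domain. -/
def PCFormDomain.ofTest (φ : ℝ → ℝ) (hφ : ContDiff ℝ ∞ φ) (hc : HasCompactSupport φ) :
    PCFormDomain where
  toFun x := (φ x : ℂ)
  wderiv x := ((deriv φ x : ℝ) : ℂ)
  continuous_toFun := Complex.continuous_ofReal.comp hφ.continuous
  hasWeakDerivative := by
    intro ψ hψ hψc
    have hd : Continuous (deriv φ) := hφ.continuous_deriv (by simp)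
    have hd' : Continuous (deriv ψ) := hψ.continuous_deriv (by simp)
    have key : ∫ x, ψ x * deriv φ x = - ∫ x, deriv ψ x * φ x := by
      refine integral_mul_deriv_eq_deriv_mul_of_integrable
        (fun x _ => (hψ.differentiable (by simp) x).hasDerivAt)
        (fun x _ => (hφ.differentiable (by simp) x).hasDerivAt) ?_ ?_ ?_
      · exact (hψ.continuous.mul hd).integrable_of_hasCompactSupport hψc.mul_right
      · exact (hd'.mul hφ.continuous).integrable_of_hasCompactSupport hc.mul_left
      · exact (hψ.continuous.mul hφ.continuous).integrable_of_hasCompactSupport hψc.mul_right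
    have e1 : ∀ x, deriv ψ x • (φ x : ℂ) = ((deriv ψ x * φ x : ℝ) : ℂ) := by
      intro x; simp
    have e2 : ∀ x, ψ x • ((deriv φ x : ℝ) : ℂ) = ((ψ x * deriv φ x : ℝ) : ℂ) := by
      intro x; simp
    simp only [e1, e2]
    rw [integral_complex_ofReal, integral_complex_ofReal, key]
    simp
  memLp_toFun :=
    (Complex.continuous_ofReal.comp hφ.continuous).memLp_of_hasCompactSupport
      (hc.comp_left Complex.ofReal_zero)
  memLp_wderiv :=
    (Complex.continuous_ofReal.comp (hφ.continuous_deriv (by simp))).memLp_of_hasCompactSupport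
      (hc.deriv.comp_left Complex.ofReal_zero)
  memLp_mul :=
    (Complex.continuous_ofReal.mul
      (Complex.continuous_ofReal.comp hφ.continuous)).memLp_of_hasCompactSupport
      (hc.comp_left (g := ((↑) : ℝ → ℂ)) Complex.ofReal_zero).mul_left

lemma integrable_mul_conj {f g : ℝ → ℂ} (hf : MemLp f 2 volume) (hg : MemLp g 2 volume) :
    Integrable (fun x => f x * conj (g x)) volume :=
  hf.integrable_mul hg.star

lemma HasWeakDerivative.add {f f' g g' : ℝ → ℂ} (hf : HasWeakDerivative f f')
    (hg : HasWeakDerivative g g') (fL : MemLp f 2 volume) (fL' : MemLp f' 2 volume)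
    (gL : MemLp g 2 volume) (gL' : MemLp g' 2 volume) :
    HasWeakDerivative (f + g) (f' + g') := by
  intro φ hφ hc
  have hd : Continuous (deriv φ) := hφ.continuous_deriv (by simp)
  have i : ∀ (ψ : ℝ → ℝ) (u : ℝ → ℂ), Continuous ψ → HasCompactSupport ψ → MemLp u 2 volume →
      Integrable (fun x => ψ x • u x) volume := fun ψ u h1 h2 h3 =>
    (h3.locallyIntegrable (by norm_num)).integrable_smul_left_of_hasCompactSupport h1 h2
  simp only [Pi.add_apply, smul_add]
  rw [integral_add (i _ _ hd hc.deriv fL) (i _ _ hd hc.deriv gL),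
    integral_add (i _ _ hφ.continuous hc fL') (i _ _ hφ.continuous hc gL'),
    hf φ hφ hc, hg φ hφ hc]
  ring

def PCFormDomain.add (f g : PCFormDomain) : PCFormDomain where
  toFun := f.toFun + g.toFun
  wderiv := f.wderiv + g.wderiv
  continuous_toFun := f.continuous_toFun.add g.continuous_toFun
  hasWeakDerivative := f.hasWeakDerivative.add g.hasWeakDerivative f.memLp_toFun f.memLp_wderiv
    g.memLp_toFun g.memLp_wderiv
  memLp_toFun := f.memLp_toFun.add g.memLp_toFun
  memLp_wderiv := f.memLp_wderiv.add g.memLp_wderiv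
  memLp_mul := by
    refine (f.memLp_mul.add g.memLp_mul).congr_norm ?_ ?_
    · exact (Complex.continuous_ofReal.mul
        (f.continuous_toFun.add g.continuous_toFun)).aestronglyMeasurable
    · exact Filter.Eventually.of_forall fun x => by simp [mul_add]

def PCFormDomain.smul (c : ℂ) (f : PCFormDomain) : PCFormDomain where
  toFun := c • f.toFun
  wderiv := c • f.wderiv
  continuous_toFun := f.continuous_toFun.const_smul c
  hasWeakDerivative := by
    intro φ hφ hc
    simp only [Pi.smul_apply, smul_comm _ c]
    rw [integral_smul, integral_smul, f.hasWeakDerivative φ hφ hc, smul_neg]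
  memLp_toFun := f.memLp_toFun.const_smul c
  memLp_wderiv := f.memLp_wderiv.const_smul c
  memLp_mul := by
    refine (f.memLp_mul.const_smul c).congr_norm ?_ ?_
    · exact (Complex.continuous_ofReal.mul
        (f.continuous_toFun.const_smul c)).aestronglyMeasurable
    · exact Filter.Eventually.of_forall fun x => by simp [mul_left_comm]

lemma pcForm_add (z : ℂ) (b : ℝ) (f₁ f₂ g : PCFormDomain) :
    pcForm z b (f₁.add f₂) g = pcForm z b f₁ g + pcForm z b f₂ g := by
  simp only [pcForm, PCFormDomain.add, Pi.add_apply, mul_add, add_mul]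
  rw [integral_add (integrable_mul_conj f₁.memLp_wderiv g.memLp_wderiv)
      (integrable_mul_conj f₂.memLp_wderiv g.memLp_wderiv),
    integral_add (integrable_mul_conj f₁.memLp_toFun g.memLp_toFun)
      (integrable_mul_conj f₂.memLp_toFun g.memLp_toFun),
    integral_add (integrable_mul_conj f₁.memLp_mul g.memLp_mul)
      (integrable_mul_conj f₂.memLp_mul g.memLp_mul)]
  ring

lemma pcForm_smul (z : ℂ) (b : ℝ) (c : ℂ) (f g : PCFormDomain) :
    pcForm z b (f.smul c) g = c * pcForm z b f g := by
  have e : ∀ x : ℝ, (x : ℂ) * (c * f.toFun x) * conj ((x : ℂ) * g.toFun x)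
      = c * ((x : ℂ) * f.toFun x * conj ((x : ℂ) * g.toFun x)) := fun x => by ring
  simp only [pcForm, PCFormDomain.smul, Pi.smul_apply, smul_eq_mul, e]
  simp only [mul_assoc c, integral_const_mul]
  ring

/-- The graph of the operator associated with the form: `(u, h)` belongs to it iff `u` lies in
the form domain and `t(u, g) = ⟨h, g⟩` for all `g` in the form domain. -/
def pcGraph (z : ℂ) (b : ℝ) :
    Submodule ℂ (Lp ℂ 2 (volume : Measure ℝ) × Lp ℂ 2 (volume : Measure ℝ)) where
  carrier := {p | ∃ f : PCFormDomain, (p.1 : ℝ → ℂ) =ᵐ[volume] f.toFun ∧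
    ∀ g : PCFormDomain, ∫ x, p.2 x * conj (g.toFun x) = pcForm z b f g}
  add_mem' := by
    rintro ⟨u, h⟩ ⟨v, k⟩ ⟨f, hf, hf'⟩ ⟨g, hg, hg'⟩
    refine ⟨f.add g, (Lp.coeFn_add u v).trans (hf.add hg), fun w => ?_⟩
    rw [pcForm_add, ← hf', ← hg',
      ← integral_add (integrable_mul_conj (Lp.memLp h) w.memLp_toFun)
        (integrable_mul_conj (Lp.memLp k) w.memLp_toFun)]
    refine integral_congr_ae ?_
    filter_upwards [Lp.coeFn_add h k] with x hx
    change (h + k : Lp ℂ 2 volume) x * _ = _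
    rw [hx, Pi.add_apply, add_mul]
  zero_mem' := by
    refine ⟨⟨0, 0, continuous_const, fun φ _ _ => by simp, MemLp.zero, MemLp.zero, by simp⟩,
      Lp.coeFn_zero _ _ _, fun w => ?_⟩
    have : ∫ x, (0 : Lp ℂ 2 (volume : Measure ℝ)) x * conj (w.toFun x) = 0 := by
      refine integral_eq_zero_of_ae ?_
      filter_upwards [Lp.coeFn_zero ℂ 2 (volume : Measure ℝ)] with x hx
      rw [hx, Pi.zero_apply, zero_mul]
    exact this.trans (by simp [pcForm])
  smul_mem' := by
    rintro c ⟨u, h⟩ ⟨f, hf, hf'⟩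
    refine ⟨f.smul c, (Lp.coeFn_smul c u).trans (hf.const_smul c), fun w => ?_⟩
    rw [pcForm_smul, ← hf', ← integral_const_mul]
    refine integral_congr_ae ?_
    filter_upwards [Lp.coeFn_smul c h] with x hx
    change (c • h : Lp ℂ 2 volume) x * _ = _
    rw [hx, Pi.smul_apply, smul_eq_mul, mul_assoc]

/-- The graph is single-valued, so the operator below is well defined. -/
lemma pcGraph_functional (z : ℂ) (b : ℝ)
    (p : Lp ℂ 2 (volume : Measure ℝ) × Lp ℂ 2 (volume : Measure ℝ))
    (hp : p ∈ pcGraph z b) (h0 : p.1 = 0) : p.2 = 0 := by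
  obtain ⟨f, hf, hf'⟩ := hp
  rw [h0] at hf
  have hf0 : f.toFun = fun _ => 0 := by
    refine (Continuous.ae_eq_iff_eq volume f.continuous_toFun continuous_const).mp ?_
    exact hf.symm.trans (Lp.coeFn_zero ℂ 2 (volume : Measure ℝ))
  have hd0 : f.wderiv =ᵐ[volume] 0 :=
    HasWeakDerivative.ae_zero (hf0 ▸ f.hasWeakDerivative) f.memLp_wderiv
  have hz : ∀ g, pcForm z b f g = 0 := by
    intro g
    have : ∫ x, f.wderiv x * conj (g.wderiv x) = 0 := by
      refine integral_eq_zero_of_ae ?_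
      filter_upwards [hd0] with x hx
      simp [hx]
    simp [pcForm, hf0, this]
  rw [Lp.eq_zero_iff_ae_eq_zero]
  refine ae_eq_zero_of_integral_contDiff_smul_eq_zero
    ((Lp.memLp p.2).locallyIntegrable (by norm_num)) fun φ hφ hc => ?_
  rw [← (hf' (.ofTest φ hφ hc)).trans (hz _)]
  refine integral_congr_ae (Filter.Eventually.of_forall fun x => ?_)
  simp [PCFormDomain.ofTest, mul_comm]

/-- The operator `-d²/dx² + (x²/4 - 1/2) + z (δ(x - b) - δ(x + b))` on `L²(ℝ)`, i.e. the
unbounded operator associated with the form `pcForm z b`: its domain consists of those `u` in the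
form domain for which there is an `h ∈ L²(ℝ)` with `t(u, g) = ⟨h, g⟩` for all `g` in the form
domain, and it sends `u` to `h`. -/
def pcOperator (z : ℂ) (b : ℝ) :
    Lp ℂ 2 (volume : Measure ℝ) →ₗ.[ℂ] Lp ℂ 2 (volume : Measure ℝ) :=
  (pcGraph z b).toLinearPMap

/-- The graph of `pcOperator` is `pcGraph`. -/
lemma pcOperator_graph (z : ℂ) (b : ℝ) : (pcOperator z b).graph = pcGraph z b :=
  Submodule.toLinearPMap_graph_eq _ fun p hp h0 => pcGraph_functional z b p hp h0

/-- `μ` is an eigenvalue of the unbounded operator `T`. -/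
def IsEigenvalue {E : Type*} [AddCommGroup E] [Module ℂ E] (T : E →ₗ.[ℂ] E) (μ : ℂ) : Prop :=
  ∃ u : T.domain, (u : E) ≠ 0 ∧ T u = μ • (u : E)

end

/-!
Let `y_ν = e^{-x²/4} He_ν` be the solution of the Weber equation that decays at `+∞`, and let
`W(ν)` be the Wronskian at `b` of `y_ν` and its reflection. Gluing `y_ν(x)` and `y_ν(-x)` at `b`
and at `-b` gives two Green's functions, and some combination of them is an eigenfunction of
`L_{z,b}` for the eigenvalue `ν` as soon as `W(ν) ≠ 0` and
`W(ν)² = z² y_ν(b)² (y_ν(-b)² - y_ν(b)²)`.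

If `D_n(b) = 0`, then `y_n` vanishes at `±b`, and Lagrange's identity
`∂_ν y_ν(c) y_n'(c) = -∫_c^∞ y_n²` at `ν = n`, `c = ±b`, gives the first order of `y_ν(±b)` and of
`W` at `ν = n`. For `z = ir` the condition becomes `(ν - n)² g(ν) = -1/r²`, where `g` is analytic
at `n` and `g(n) > 0` because `∫_{-b}^∞ y_n² > ∫_b^∞ y_n²`. It has two roots
`ν = n ± i / (r √g(n)) + o(1/r)`.
-/

noncomputable section

open Set Filter Topology

/-- The kernel `e^{-xt - t²/2}` whose Mellin transform in `t` represents the Hermite functions of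
non-integer order. -/
def gaussKernel (x t : ℝ) : ℝ := Real.exp (-(x * t) - t ^ 2 / 2)

/-- The Mellin transform `∫_0^∞ t^{s-1} e^{-xt - t²/2} dt`. -/
def gaussMellin (s : ℂ) (x : ℝ) : ℂ := mellin (fun t => (gaussKernel x t : ℂ)) s

lemma gaussKernel_pos (x t : ℝ) : 0 < gaussKernel x t := Real.exp_pos _

lemma continuous_gaussKernel (x : ℝ) : Continuous (gaussKernel x) := by
  unfold gaussKernel; fun_prop

lemma norm_ofReal_gaussKernel (x t : ℝ) : ‖(gaussKernel x t : ℂ)‖ = gaussKernel x t := by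
  rw [Complex.norm_real, Real.norm_of_nonneg (gaussKernel_pos x t).le]

lemma gaussKernel_le_exp_neg (x t : ℝ) :
    gaussKernel x t ≤ Real.exp ((1 - x) ^ 2 / 2) * Real.exp (-1 * t) := by
  rw [gaussKernel, ← Real.exp_add]
  exact Real.exp_le_exp.2 (by nlinarith [sq_nonneg (t - (1 - x))])

lemma gaussKernel_antitone_left {t : ℝ} (ht : 0 ≤ t) : Antitone fun x => gaussKernel x t :=
  fun _ _ hxy => Real.exp_le_exp.2 (by nlinarith [mul_le_mul_of_nonneg_right hxy ht])

lemma hasDerivAt_gaussKernel_left (x t : ℝ) :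
    HasDerivAt (fun x => gaussKernel x t) (-t * gaussKernel x t) x := by
  have h : HasDerivAt (fun x : ℝ => -(x * t) - t ^ 2 / 2) (-t) x := by
    simpa using (((hasDerivAt_id x).mul_const t).neg).sub_const (t ^ 2 / 2)
  exact h.exp.congr_deriv (mul_comm _ _)

lemma hasDerivAt_gaussKernel (x t : ℝ) :
    HasDerivAt (gaussKernel x) (-(x + t) * gaussKernel x t) t := by
  have h : HasDerivAt (fun t : ℝ => -(x * t) - t ^ 2 / 2) (-(x + t)) t :=
    (((hasDerivAt_id t).const_mul x).neg.sub (((hasDerivAt_id t).pow 2).div_const 2)).congr_deriv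
      (by simp; ring)
  exact h.exp.congr_deriv (mul_comm _ _)

lemma gaussKernel_isBigO_atTop (x : ℝ) :
    (fun t => (gaussKernel x t : ℂ)) =O[atTop] fun t => Real.exp (-1 * t) := by
  refine .of_bound (Real.exp ((1 - x) ^ 2 / 2)) (.of_forall fun t => ?_)
  rw [norm_ofReal_gaussKernel, Real.norm_of_nonneg (Real.exp_pos _).le]
  exact gaussKernel_le_exp_neg x t

lemma gaussKernel_isBigO_nhdsGT_zero (x : ℝ) :
    (fun t => (gaussKernel x t : ℂ)) =O[𝓝[>] 0] fun t => t ^ (-(0 : ℝ)) := by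
  simp only [neg_zero, Real.rpow_zero]
  exact (((Complex.continuous_ofReal.comp (continuous_gaussKernel x)).tendsto 0).mono_left
    nhdsWithin_le_nhds).isBigO_one ℝ

lemma locallyIntegrableOn_gaussKernel (x : ℝ) (S : Set ℝ) :
    LocallyIntegrableOn (fun t => (gaussKernel x t : ℂ)) S :=
  (Complex.continuous_ofReal.comp (continuous_gaussKernel x)).locallyIntegrable.locallyIntegrableOn
    S

lemma mellinConvergent_gaussKernel {s : ℂ} (hs : 0 < s.re) (x : ℝ) :
    MellinConvergent (fun t => (gaussKernel x t : ℂ)) s :=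
  mellinConvergent_of_isBigO_rpow_exp one_pos (locallyIntegrableOn_gaussKernel x _)
    (gaussKernel_isBigO_atTop x) (gaussKernel_isBigO_nhdsGT_zero x) hs

lemma differentiableAt_gaussMellin {s : ℂ} (hs : 0 < s.re) (x : ℝ) :
    DifferentiableAt ℂ (fun s => gaussMellin s x) s :=
  mellin_differentiableAt_of_isBigO_rpow_exp one_pos (locallyIntegrableOn_gaussKernel x _)
    (gaussKernel_isBigO_atTop x) (gaussKernel_isBigO_nhdsGT_zero x) hs

lemma norm_cpow_smul_gaussKernel (s : ℂ) (x : ℝ) {t : ℝ} (ht : 0 < t) :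
    ‖(t : ℂ) ^ (s - 1) • (gaussKernel x t : ℂ)‖ = t ^ (s.re - 1) * gaussKernel x t := by
  simp [Complex.norm_cpow_eq_rpow_re_of_pos ht, (gaussKernel_pos x t).le]

lemma integrableOn_rpow_mul_gaussKernel {σ : ℝ} (hσ : 0 < σ) (x : ℝ) :
    IntegrableOn (fun t => t ^ (σ - 1) * gaussKernel x t) (Ioi 0) := by
  have h := (mellinConvergent_gaussKernel (s := (σ : ℂ)) (by simpa using hσ) x).norm
  refine (integrableOn_congr_fun (fun t ht => ?_) measurableSet_Ioi).1 h
  rw [norm_cpow_smul_gaussKernel _ _ ht, Complex.ofReal_re]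

lemma ofReal_cpow_eq_mul_cpow_sub_one (s : ℂ) {t : ℝ} (ht : 0 < t) :
    (t : ℂ) ^ s = t * (t : ℂ) ^ (s - 1) := by
  have ht' : (t : ℂ) ≠ 0 := by exact_mod_cast ht.ne'
  rw [Complex.cpow_sub _ _ ht', Complex.cpow_one, mul_div_cancel₀ _ ht']

lemma hasDerivAt_gaussMellin {s : ℂ} (hs : 0 < s.re) (x : ℝ) :
    HasDerivAt (fun x => gaussMellin s x) (-gaussMellin (s + 1) x) x := by
  have hs1 : 0 < (s + 1).re := by simp; linarith
  have h := hasDerivAt_integral_of_dominated_loc_of_deriv_le (𝕜 := ℝ) (x₀ := x)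
    (μ := volume.restrict (Ioi (0 : ℝ))) (s := Metric.ball x 1)
    (F := fun x t => (t : ℂ) ^ (s - 1) • (gaussKernel x t : ℂ))
    (F' := fun x t => -((t : ℂ) ^ (s + 1 - 1) • (gaussKernel x t : ℂ)))
    (bound := fun t => t ^ ((s + 1).re - 1) * gaussKernel (x - 1) t)
    (Metric.ball_mem_nhds x one_pos)
    (.of_forall fun y => (mellinConvergent_gaussKernel hs y).aestronglyMeasurable)
    (mellinConvergent_gaussKernel hs x)
    (mellinConvergent_gaussKernel hs1 x).aestronglyMeasurable.neg ?_
    (integrableOn_rpow_mul_gaussKernel hs1 (x - 1)) ?_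
  · exact h.2.congr_deriv (integral_neg _)
  · filter_upwards [ae_restrict_mem measurableSet_Ioi] with t (ht : 0 < t) y hy
    rw [norm_neg, norm_cpow_smul_gaussKernel _ _ ht]
    have hy' : x - 1 ≤ y := by
      rw [Metric.mem_ball, Real.dist_eq] at hy; linarith [(abs_lt.1 hy).1]
    exact mul_le_mul_of_nonneg_left (gaussKernel_antitone_left ht.le hy')
      (Real.rpow_nonneg ht.le _)
  · filter_upwards [ae_restrict_mem measurableSet_Ioi] with t ht y _
    refine ((hasDerivAt_gaussKernel_left y t).ofReal_comp.const_mul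
      ((t : ℂ) ^ (s - 1))).congr_deriv ?_
    rw [add_sub_cancel_right, ofReal_cpow_eq_mul_cpow_sub_one s ht]
    simp only [smul_eq_mul]; push_cast; ring

lemma hasDerivAt_cpow_mul_gaussKernel (s : ℂ) (x : ℝ) {t : ℝ} (ht : 0 < t) :
    HasDerivAt (fun t : ℝ => (t : ℂ) ^ s * (gaussKernel x t : ℂ))
      (s * ((t : ℂ) ^ (s - 1) * gaussKernel x t) - x * ((t : ℂ) ^ (s + 1 - 1) * gaussKernel x t)
        - (t : ℂ) ^ (s + 2 - 1) * gaussKernel x t) t := by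
  have hpow : HasDerivAt (fun t : ℝ => (t : ℂ) ^ s) (s * (t : ℂ) ^ (s - 1)) t := by
    simpa using ((hasDerivAt_id (t : ℂ)).cpow_const (c := s) (.inl (by simpa using ht))).comp_ofReal
  refine (hpow.mul (hasDerivAt_gaussKernel x t).ofReal_comp).congr_deriv ?_
  rw [show s + 2 - 1 = s + 1 by ring, ofReal_cpow_eq_mul_cpow_sub_one (s + 1) ht,
    add_sub_cancel_right]
  push_cast; ring

lemma tendsto_cpow_mul_gaussKernel_atTop (s : ℂ) (x : ℝ) :
    Tendsto (fun t : ℝ => (t : ℂ) ^ s * (gaussKernel x t : ℂ)) atTop (𝓝 0) := by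
  have hlim := (tendsto_rpow_mul_exp_neg_mul_atTop_nhds_zero s.re 1 one_pos).const_mul
    (Real.exp ((1 - x) ^ 2 / 2))
  rw [mul_zero] at hlim
  refine squeeze_zero_norm' ?_ hlim
  filter_upwards [eventually_gt_atTop 0] with t ht
  rw [norm_mul, Complex.norm_cpow_eq_rpow_re_of_pos ht, norm_ofReal_gaussKernel, mul_left_comm]
  exact mul_le_mul_of_nonneg_left (gaussKernel_le_exp_neg x t) (Real.rpow_nonneg ht.le _)

lemma gaussMellin_recurrence {s : ℂ} (hs : 0 < s.re) (x : ℝ) :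
    gaussMellin (s + 2) x + x * gaussMellin (s + 1) x = s * gaussMellin s x := by
  have hs0 : s ≠ 0 := by rintro rfl; simp at hs
  have c0 := (mellinConvergent_gaussKernel hs x).const_mul s
  have c1 := (mellinConvergent_gaussKernel (s := s + 1) (by simp; linarith) x).const_mul (x : ℂ)
  have c2 := mellinConvergent_gaussKernel (s := s + 2) (by simp; linarith) x
  have hcont : ContinuousWithinAt (fun t : ℝ => (t : ℂ) ^ s * (gaussKernel x t : ℂ)) (Ici 0) 0 :=
    ((Complex.continuousAt_ofReal_cpow_const _ _ (.inl hs)).mul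
      (Complex.continuous_ofReal.comp (continuous_gaussKernel x)).continuousAt).continuousWithinAt
  have hFTC := integral_Ioi_of_hasDerivAt_of_tendsto hcont
    (fun t ht => hasDerivAt_cpow_mul_gaussKernel s x ht) ((c0.sub c1).sub c2)
    (tendsto_cpow_mul_gaussKernel_atTop s x)
  have hsplit : ∫ t in Ioi (0 : ℝ), (s * ((t : ℂ) ^ (s - 1) * gaussKernel x t)
        - x * ((t : ℂ) ^ (s + 1 - 1) * gaussKernel x t) - (t : ℂ) ^ (s + 2 - 1) * gaussKernel x t)
      = s * gaussMellin s x - x * gaussMellin (s + 1) x - gaussMellin (s + 2) x := by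
    rw [integral_sub (by exact c0.sub c1) (by exact c2), integral_sub (by exact c0) (by exact c1)]
    simp only [gaussMellin, mellin, smul_eq_mul, integral_const_mul]
  rw [hsplit, Complex.ofReal_zero, Complex.zero_cpow hs0, zero_mul] at hFTC
  linear_combination -hFTC

lemma rpow_le_rpow_add_rpow {a b c t : ℝ} (ht : 0 < t) (hab : a ≤ b) (hbc : b ≤ c) :
    t ^ b ≤ t ^ a + t ^ c := by
  have ha := Real.rpow_nonneg ht.le a
  have hc := Real.rpow_nonneg ht.le c
  rcases le_total t 1 with h | h
  · linarith [Real.rpow_le_rpow_of_exponent_ge ht h hab]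
  · linarith [Real.rpow_le_rpow_of_exponent_le h hbc]

lemma eventually_norm_gaussMellin_le {s₀ : ℂ} (hs : 0 < s₀.re) (c : ℝ) :
    ∃ C : ℝ, ∀ᶠ s in 𝓝 s₀, ∀ x, c ≤ x → ‖gaussMellin s x‖ ≤ C := by
  set σ := s₀.re
  have i1 := integrableOn_rpow_mul_gaussKernel (σ := σ / 2) (by positivity) c
  have i2 := integrableOn_rpow_mul_gaussKernel (σ := σ + 1) (by positivity) c
  refine ⟨∫ t in Ioi (0 : ℝ), (t ^ (σ / 2 - 1) * gaussKernel c t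
    + t ^ (σ + 1 - 1) * gaussKernel c t), ?_⟩
  filter_upwards [Complex.continuous_re.continuousAt.eventually_const_lt (half_lt_self hs),
    Complex.continuous_re.continuousAt.eventually_lt_const (lt_add_one σ)] with s h1 h2 x hx
  refine norm_integral_le_of_norm_le (i1.add i2) ?_
  filter_upwards [ae_restrict_mem measurableSet_Ioi] with t (ht : 0 < t)
  calc ‖(t : ℂ) ^ (s - 1) • (gaussKernel x t : ℂ)‖
      = t ^ (s.re - 1) * gaussKernel x t := norm_cpow_smul_gaussKernel _ _ ht
    _ ≤ (t ^ (σ / 2 - 1) + t ^ (σ + 1 - 1)) * gaussKernel c t := by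
        gcongr ?_ * ?_
        · exact (gaussKernel_pos x t).le
        · exact rpow_le_rpow_add_rpow ht (by linarith) (by linarith)
        · exact gaussKernel_antitone_left ht.le hx
    _ = _ := add_mul _ _ _

/-- The Hermite function `He_ν(x)` of complex order `ν`, the solution of `y'' - x y' + ν y = 0` of
moderate growth at `+∞`. For `Re ν < 0` it is `Γ(-ν)⁻¹ ∫_0^∞ t^{-ν-1} e^{-xt - t²/2} dt`;
`complexHermite k` continues this by `k` steps of the three-term recurrence and is meaningful for
`Re ν < k` only. -/
def complexHermite : ℕ → ℂ → ℝ → ℂ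
  | 0, ν, x => gaussMellin (-ν) x * (Complex.Gamma (-ν))⁻¹
  | k + 1, ν, x => x * complexHermite k (ν - 1) x - (ν - 1) * complexHermite k (ν - 2) x

lemma complexHermite_succ (k : ℕ) (ν : ℂ) (x : ℝ) :
    complexHermite (k + 1) ν x
      = x * complexHermite k (ν - 1) x - (ν - 1) * complexHermite k (ν - 2) x := rfl

lemma complexHermite_zero_recurrence {ν : ℂ} (hν : ν.re < 0) (x : ℝ) :
    complexHermite 0 ν x
      = x * complexHermite 0 (ν - 1) x - (ν - 1) * complexHermite 0 (ν - 2) x := by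
  have hs : 0 < (-ν).re := by simpa using hν
  have hν0 : ν ≠ 0 := by rintro rfl; simp at hν
  have hs1 : -ν + 1 ≠ 0 := fun h => by
    have := congrArg Complex.re h
    simp at this; linarith
  have hG := Complex.Gamma_ne_zero_of_re_pos hs
  have hM := gaussMellin_recurrence hs x
  simp only [complexHermite]
  rw [show -(ν - 2) = -ν + 1 + 1 by ring, show -(ν - 1) = -ν + 1 by ring,
    Complex.Gamma_add_one _ hs1, Complex.Gamma_add_one _ (neg_ne_zero.2 hν0)]
  rw [show -ν + 2 = -ν + 1 + 1 by ring] at hM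
  field_simp
  linear_combination (1 - ν) * hM

lemma complexHermite_recurrence (k : ℕ) {ν : ℂ} (hν : ν.re < k) (x : ℝ) :
    complexHermite k ν x
      = x * complexHermite k (ν - 1) x - (ν - 1) * complexHermite k (ν - 2) x := by
  induction k generalizing ν with
  | zero => exact complexHermite_zero_recurrence (by simpa using hν) x
  | succ k ih =>
    push_cast at hν
    conv_rhs => rw [complexHermite_succ, complexHermite_succ,
      ← ih (by simp; linarith), ← ih (by simp; linarith)]
    exact complexHermite_succ k ν x

lemma complexHermite_succ_eq {k : ℕ} {ν : ℂ} (hν : ν.re < k) (x : ℝ) :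
    complexHermite (k + 1) ν x = complexHermite k ν x :=
  (complexHermite_recurrence k hν x).symm

lemma hasDerivAt_complexHermite (k : ℕ) {ν : ℂ} (hν : ν.re < k) (x : ℝ) :
    HasDerivAt (complexHermite k ν) (ν * complexHermite k (ν - 1) x) x := by
  induction k generalizing ν with
  | zero =>
    have hs : 0 < (-ν).re := by simpa using hν
    have hν0 : ν ≠ 0 := by rintro rfl; simp at hν
    have hG := Complex.Gamma_ne_zero_of_re_pos hs
    refine ((hasDerivAt_gaussMellin hs x).mul_const (Complex.Gamma (-ν))⁻¹).congr_deriv ?_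
    simp only [complexHermite]
    rw [show -(ν - 1) = -ν + 1 by ring, Complex.Gamma_add_one _ (neg_ne_zero.2 hν0)]
    field_simp
  | succ k ih =>
    push_cast at hν
    have h1 : (ν - 1).re < k := by simp; linarith
    have h2 : (ν - 2).re < k := by simp; linarith
    refine (((hasDerivAt_id x).ofReal_comp.mul (ih h1)).sub
      ((ih h2).const_mul (ν - 1))).congr_deriv ?_
    have hrec := complexHermite_recurrence k h1 x
    rw [complexHermite_succ_eq h1]
    rw [show ν - 1 - 2 = ν - 2 - 1 by ring, show ν - 1 - 1 = ν - 2 by ring] at hrec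
    rw [show ν - 1 - 1 = ν - 2 by ring]
    simp only [id, Complex.ofReal_one]
    linear_combination (1 - ν) * hrec

lemma differentiableAt_complexHermite_left (k : ℕ) {ν : ℂ} (hν : ν.re < k) (x : ℝ) :
    DifferentiableAt ℂ (fun ν => complexHermite k ν x) ν := by
  induction k generalizing ν with
  | zero =>
    have hs : 0 < (-ν).re := by simpa using hν
    exact ((differentiableAt_gaussMellin hs x).mul
      (Complex.differentiable_one_div_Gamma (-ν))).comp ν (f := Neg.neg) differentiableAt_id.neg
  | succ k ih =>
    push_cast at hν
    have d1 : DifferentiableAt ℂ (fun ν => complexHermite k (ν - 1) x) ν :=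
      (ih (ν := ν - 1) (by simp; linarith)).comp ν (f := fun ν => ν - 1) (by fun_prop)
    have d2 : DifferentiableAt ℂ (fun ν => complexHermite k (ν - 2) x) ν :=
      (ih (ν := ν - 2) (by simp; linarith)).comp ν (f := fun ν => ν - 2) (by fun_prop)
    simp only [complexHermite_succ]
    fun_prop

lemma eventually_norm_lt_of_continuous {X E : Type*} [TopologicalSpace X]
    [SeminormedAddCommGroup E] {f : X → E} (hf : Continuous f) (a : X) :
    ∀ᶠ z in 𝓝 a, ‖f z‖ < ‖f a‖ + 1 :=
  hf.norm.continuousAt.eventually_lt_const (lt_add_one _)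

lemma eventually_norm_complexHermite_le (k : ℕ) (c : ℝ) {ν₀ : ℂ} (hν : ν₀.re < k) :
    ∃ C : ℝ, 0 ≤ C ∧
      ∀ᶠ ν in 𝓝 ν₀, ∀ x, c ≤ x → ‖complexHermite k ν x‖ ≤ C * (1 + |x|) ^ k := by
  induction k generalizing ν₀ with
  | zero =>
    have hs : 0 < (-ν₀).re := by simpa using hν
    obtain ⟨C, hC⟩ := eventually_norm_gaussMellin_le hs c
    have hD :=
      eventually_norm_lt_of_continuous Complex.differentiable_one_div_Gamma.continuous (-ν₀)
    refine ⟨|C| * (‖(Complex.Gamma (-ν₀))⁻¹‖ + 1), by positivity, ?_⟩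
    filter_upwards [continuous_neg.continuousAt.eventually hC,
      continuous_neg.continuousAt.eventually hD] with ν h1 h2 x hx
    simp only [complexHermite, pow_zero, mul_one, norm_mul]
    exact mul_le_mul ((h1 x hx).trans (le_abs_self C)) h2.le (norm_nonneg _) (abs_nonneg _)
  | succ k ih =>
    push_cast at hν
    obtain ⟨C₁, p₁, e₁⟩ := ih (ν₀ := ν₀ - 1) (by simp; linarith)
    obtain ⟨C₂, p₂, e₂⟩ := ih (ν₀ := ν₀ - 2) (by simp; linarith)
    refine ⟨C₁ + (‖ν₀ - 1‖ + 1) * C₂, by positivity, ?_⟩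
    filter_upwards [(continuous_sub_right (1 : ℂ)).continuousAt.eventually e₁,
      (continuous_sub_right (2 : ℂ)).continuousAt.eventually e₂,
      eventually_norm_lt_of_continuous (continuous_sub_right (1 : ℂ)) ν₀] with ν h1 h2 h3 x hx
    have hx0 := abs_nonneg x
    calc ‖complexHermite (k + 1) ν x‖
        ≤ |x| * ‖complexHermite k (ν - 1) x‖ + ‖ν - 1‖ * ‖complexHermite k (ν - 2) x‖ := by
          rw [complexHermite_succ]
          refine (norm_sub_le _ _).trans ?_
          rw [norm_mul, norm_mul, Complex.norm_real, Real.norm_eq_abs]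
      _ ≤ (1 + |x|) * (C₁ * (1 + |x|) ^ k)
          + (‖ν₀ - 1‖ + 1) * (C₂ * (1 + |x|) ^ k) * (1 + |x|) := by
          refine add_le_add (mul_le_mul (by linarith) (h1 x hx) (norm_nonneg _) (by linarith))
            ((mul_le_mul h3.le (h2 x hx) (norm_nonneg _) (by positivity)).trans ?_)
          exact le_mul_of_one_le_right (by positivity) (by linarith)
      _ = _ := by ring

lemma gaussMellin_two_zero : gaussMellin 2 0 = 1 := by
  have h := integral_mul_cexp_neg_mul_sq (b := 1 / 2) (by norm_num)
  norm_num at h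
  rw [← h, gaussMellin, mellin]
  refine setIntegral_congr_fun measurableSet_Ioi fun t _ => ?_
  simp only [gaussKernel, smul_eq_mul]
  push_cast
  rw [show (2 : ℂ) - 1 = 1 by norm_num, Complex.cpow_one]
  congr 2
  ring

lemma complexHermite_order_zero {k : ℕ} (hk : 0 < k) (x : ℝ) : complexHermite k 0 x = 1 := by
  induction k, hk using Nat.le_induction with
  | base =>
    have hderiv : ∀ y, HasDerivAt (complexHermite 1 0) 0 y := fun y =>
      (hasDerivAt_complexHermite 1 (by simp) y).congr_deriv (zero_mul _)
    rw [is_const_of_deriv_eq_zero (fun y => (hderiv y).differentiableAt) (fun y => (hderiv y).deriv)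
      x 0]
    simp [complexHermite, gaussMellin_two_zero]
  | succ k hk ih => rw [complexHermite_succ_eq (by simpa using Nat.pos_of_ne_zero (by omega)), ih]

lemma complexHermite_natCast {n k : ℕ} (hk : n < k) (x : ℝ) :
    complexHermite k n x = ((Polynomial.aeval x (Polynomial.hermite n) : ℝ) : ℂ) := by
  induction n generalizing x with
  | zero => simpa using complexHermite_order_zero hk x
  | succ n ih =>
    have hk' : (n : ℝ) + 1 < k := by exact_mod_cast hk
    have ih := fun x => ih (by omega) x
    have hrec := complexHermite_recurrence k (ν := (n + 1 : ℕ)) (by simpa using hk') x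
    have hderiv : HasDerivAt (complexHermite k n)
        ((Polynomial.aeval x (Polynomial.derivative (Polynomial.hermite n)) : ℝ) : ℂ) x := by
      rw [funext ih]
      exact ((Polynomial.hermite n).hasDerivAt_aeval x).ofReal_comp
    have hderiv_eq := (hasDerivAt_complexHermite k (ν := n) (by simp; linarith) x).unique hderiv
    rw [hrec, Polynomial.hermite_succ]
    push_cast
    simp only [map_sub, map_mul, Polynomial.aeval_X, Complex.ofReal_sub, Complex.ofReal_mul]
    rw [← hderiv_eq, ← ih x, show (n : ℂ) + 1 - 1 = n by ring, show (n : ℂ) + 1 - 2 = n - 1 by ring]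

lemma exists_tsupport_subset_Ioo {E : Type*} [Zero E] {φ : ℝ → E} (hc : HasCompactSupport φ)
    (r : ℝ) : ∃ R, r < R ∧ tsupport φ ⊆ Ioo (-R) R := by
  obtain ⟨R, hrR, hR⟩ := hc.isCompact.isBounded.subset_ball_lt r 0
  exact ⟨R, hrR, by simpa [Real.ball_eq_Ioo] using hR⟩

lemma exists_deriv_eq_of_integral_eq_zero {φ : ℝ → ℝ} (hφ : ContDiff ℝ ∞ φ)
    (hc : HasCompactSupport φ) (h0 : ∫ x, φ x = 0) :
    ∃ Φ : ℝ → ℝ, ContDiff ℝ ∞ Φ ∧ HasCompactSupport Φ ∧ deriv Φ = φ := by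
  obtain ⟨R, -, hR⟩ := exists_tsupport_subset_Ioo hc 0
  have hsupp : Function.support φ ⊆ Ioo (-R) R := (subset_tsupport φ).trans hR
  have hderiv : ∀ x, HasDerivAt (fun x => ∫ t in (-R)..x, φ t) (φ x) x := fun x =>
    (hφ.continuous.integral_hasStrictDerivAt _ x).hasDerivAt
  refine ⟨fun x => ∫ t in (-R)..x, φ t, ?_, ?_, funext fun x => (hderiv x).deriv⟩
  · rw [contDiff_infty_iff_deriv]
    exact ⟨fun x => (hderiv x).differentiableAt, by rwa [funext fun x => (hderiv x).deriv]⟩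
  · refine .intro (isCompact_Icc (a := -R) (b := R)) fun x hx => ?_
    rw [mem_Icc, not_and_or, not_le, not_le] at hx
    rcases hx with hx | hx
    · rw [intervalIntegral.integral_of_ge hx.le, setIntegral_eq_zero_of_forall_eq_zero, neg_zero]
      exact fun t ht => Function.notMem_support.1 fun h => (hsupp h).1.not_ge ht.2
    · rw [intervalIntegral.integral_eq_integral_of_support_subset, h0]
      exact hsupp.trans fun t ht => ⟨ht.1, ht.2.le.trans hx.le⟩

lemma HasWeakDerivative.ae_eq_const {f : ℝ → ℂ} (h : HasWeakDerivative f 0)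
    (hf : LocallyIntegrable f) : ∃ C, f =ᵐ[volume] fun _ => C := by
  let η : ContDiffBump (0 : ℝ) := default
  have hηc : HasCompactSupport (η.normed volume) := η.hasCompactSupport_normed
  have hη : ContDiff ℝ ∞ (η.normed volume) := η.contDiff_normed
  have hint : ∀ {ψ : ℝ → ℝ}, ContDiff ℝ ∞ ψ → HasCompactSupport ψ →
      Integrable fun x => ψ x • f x := fun hψ hψc =>
    hf.integrable_smul_left_of_hasCompactSupport hψ.continuous hψc
  refine ⟨∫ x, η.normed volume x • f x, ?_⟩
  refine ae_eq_of_integral_contDiff_smul_eq hf continuous_const.locallyIntegrable fun ψ hψ hψc => ?_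
  set c := ∫ x, ψ x
  obtain ⟨Φ, hΦ, hΦc, hΦ'⟩ := exists_deriv_eq_of_integral_eq_zero
    (φ := fun x => ψ x - c * η.normed volume x) (hψ.sub (contDiff_const.mul hη))
    (hψc.sub hηc.mul_left) (by
      rw [integral_sub (hψ.continuous.integrable_of_hasCompactSupport hψc)
        ((hη.continuous.integrable_of_hasCompactSupport hηc).const_mul c), integral_const_mul,
        η.integral_normed, mul_one, sub_self])
  have h0 := h Φ hΦ hΦc
  simp only [hΦ', sub_smul, mul_smul, Pi.zero_apply, smul_zero, integral_zero, neg_zero] at h0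
  rw [integral_sub (hint hψ hψc) (by exact (hint hη hηc).smul c), integral_smul] at h0
  rw [integral_smul_const, sub_eq_zero.1 h0]

lemma intervalIntegrable_of_locallyIntegrable {E : Type*} [NormedAddCommGroup E] {f : ℝ → E}
    (hf : LocallyIntegrable f) (a b : ℝ) : IntervalIntegrable f volume a b :=
  intervalIntegrable_iff.2 <|
    (hf.integrableOn_isCompact isCompact_uIcc).mono_set uIoc_subset_uIcc

lemma integral_deriv_mul_primitive {φ f : ℝ → ℝ} (hφ : ContDiff ℝ 1 φ) (hc : HasCompactSupport φ)
    (hf : LocallyIntegrable f) (a : ℝ) :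
    ∫ x, deriv φ x * (∫ t in a..x, f t) = -∫ x, φ x * f x := by
  obtain ⟨R, haR, hR⟩ := exists_tsupport_subset_Ioo hc |a|
  have hsupp : tsupport φ ⊆ Ioc (-R) R := hR.trans Ioo_subset_Ioc_self
  have ha : a ∈ uIcc (-R) R := by
    rw [uIcc_of_le (by linarith [abs_nonneg a])]
    exact ⟨by linarith [neg_abs_le a], by linarith [le_abs_self a]⟩
  have hzero : ∀ x ∉ Ioo (-R) R, φ x = 0 := fun x hx =>
    image_eq_zero_of_notMem_tsupport fun h => hx (hR h)
  have hIBP := (hφ.contDiffOn.absolutelyContinuousOnInterval (a := -R) (b := R)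
    ).integral_mul_deriv_eq_deriv_mul
      ((intervalIntegrable_of_locallyIntegrable hf _ _
        ).absolutelyContinuousOnInterval_intervalIntegral ha)
  rw [hzero R (by simp), hzero (-R) (by simp), zero_mul, zero_mul, sub_self, zero_sub] at hIBP
  have hae : ∀ᵐ x, φ x * deriv (fun x => ∫ t in a..x, f t) x = φ x * f x := by
    filter_upwards [LocallyIntegrable.ae_hasDerivAt_integral hf] with x hx
    rw [(hx a).deriv]
  rw [← integral_congr_ae hae,
    ← intervalIntegral.integral_eq_integral_of_support_subset (a := -R) (b := R)
      ((Function.support_mul_subset_left _ _).trans ((subset_tsupport φ).trans hsupp)),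
    ← intervalIntegral.integral_eq_integral_of_support_subset (a := -R) (b := R)
      ((Function.support_mul_subset_left _ _).trans ((support_deriv_subset (f := φ)).trans hsupp)),
    hIBP, neg_neg]

lemma hasWeakDerivative_primitive {f : ℝ → ℂ} (hf : LocallyIntegrable f) (a : ℝ) :
    HasWeakDerivative (fun x => ∫ t in a..x, f t) f := by
  intro φ hφ hc
  have hint : ∀ {ψ : ℝ → ℝ} {u : ℝ → ℂ}, Continuous ψ → HasCompactSupport ψ →
      LocallyIntegrable u → Integrable fun x => ψ x • u x := fun hψ hψc hu =>
    hu.integrable_smul_left_of_hasCompactSupport hψ hψc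
  have hF : LocallyIntegrable fun x => ∫ t in a..x, f t :=
    (intervalIntegral.continuous_primitive
      (intervalIntegrable_of_locallyIntegrable hf) a).locallyIntegrable
  have hpart : ∀ L : ℂ →L[ℝ] ℝ, L (∫ x, deriv φ x • ∫ t in a..x, f t) = L (-∫ x, φ x • f x) := by
    intro L
    have hLf : LocallyIntegrable fun x => L (f x) := fun x =>
      let ⟨U, hU, hi⟩ := hf x; ⟨U, hU, L.integrable_comp hi⟩
    rw [map_neg, ← L.integral_comp_comm (hint (hφ.continuous_deriv (by simp)) hc.deriv hF),
      ← L.integral_comp_comm (hint hφ.continuous hc hf)]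
    simp only [map_smul, smul_eq_mul,
      ← L.intervalIntegral_comp_comm (intervalIntegrable_of_locallyIntegrable hf _ _)]
    exact integral_deriv_mul_primitive (hφ.of_le (by simp)) hc hLf a
  exact Complex.ext (hpart Complex.reCLM) (hpart Complex.imCLM)

lemma HasWeakDerivative.integral_eq_sub {g g' : ℝ → ℂ} (h : HasWeakDerivative g g')
    (hg : Continuous g) (hg' : LocallyIntegrable g') (a b : ℝ) :
    ∫ x in a..b, g' x = g b - g a := by
  set G : ℝ → ℂ := fun x => ∫ t in a..x, g' t
  have hG : Continuous G :=
    intervalIntegral.continuous_primitive (intervalIntegrable_of_locallyIntegrable hg') a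
  have hsub : HasWeakDerivative (fun x => g x - G x) 0 := fun φ hφ hc => by
    have hd : Continuous (deriv φ) := hφ.continuous_deriv (by simp)
    simp only [smul_sub]
    rw [integral_sub (by exact (hd.smul hg).integrable_of_hasCompactSupport hc.deriv.smul_right)
      (by exact (hd.smul hG).integrable_of_hasCompactSupport hc.deriv.smul_right), h φ hφ hc,
      hasWeakDerivative_primitive hg' a φ hφ hc]
    simp
  obtain ⟨C, hC⟩ := hsub.ae_eq_const (hg.sub hG).locallyIntegrable
  have hconst := (Continuous.ae_eq_iff_eq volume (hg.sub hG) continuous_const).1 hC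
  have hab : g b - G b = g a - G a := (congrFun hconst b).trans (congrFun hconst a).symm
  have hGa : G a = 0 := intervalIntegral.integral_same
  linear_combination -hab + hGa

lemma hasWeakDerivative_of_hasDerivAt_off_countable {f f' : ℝ → ℂ} {S : Set ℝ} (hS : S.Countable)
    (hf : Continuous f) (hd : ∀ x ∉ S, HasDerivAt f (f' x) x) (hf' : LocallyIntegrable f') :
    HasWeakDerivative f f' := by
  intro φ hφ hc
  obtain ⟨R, -, hR⟩ := exists_tsupport_subset_Ioo hc 0
  have hsupp : tsupport φ ⊆ Ioc (-R) R := hR.trans Ioo_subset_Ioc_self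
  have hzero : ∀ x ∉ Ioo (-R) R, φ x = 0 := fun x hx =>
    image_eq_zero_of_notMem_tsupport fun h => hx (hR h)
  have hi : Integrable fun x => deriv φ x • f x :=
    ((hφ.continuous_deriv (by simp)).smul hf).integrable_of_hasCompactSupport hc.deriv.smul_right
  have hi' : Integrable fun x => φ x • f' x :=
    hf'.integrable_smul_left_of_hasCompactSupport hφ.continuous hc
  have hFTC := integral_eq_of_hasDerivAt_off_countable (a := -R) (b := R) (fun x => φ x • f x)
    (fun x => φ x • f' x + deriv φ x • f x) hS (hφ.continuous.smul hf).continuousOn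
    (fun x hx => (hφ.differentiable (by simp) x).hasDerivAt.smul (hd x hx.2))
    (hi'.add hi).intervalIntegrable
  rw [hzero R (by simp), hzero (-R) (by simp), zero_smul, zero_smul, sub_self,
    intervalIntegral.integral_add hi'.intervalIntegrable hi.intervalIntegrable,
    intervalIntegral.integral_eq_integral_of_support_subset
      fun x hx => hsupp (subset_tsupport φ (left_ne_zero_of_smul hx)),
    intervalIntegral.integral_eq_integral_of_support_subset
      fun x hx => hsupp (support_deriv_subset (left_ne_zero_of_smul hx))]
    at hFTC
  linear_combination hFTC

lemma HasWeakDerivative.integral_deriv_mul {g g' φ : ℝ → ℂ} (h : HasWeakDerivative g g')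
    (hg : LocallyIntegrable g) (hg' : LocallyIntegrable g') (hφ : ContDiff ℝ ∞ φ)
    (hc : HasCompactSupport φ) : ∫ x, deriv φ x * g x = -∫ x, φ x * g' x := by
  have hsplit : ∀ {ψ u : ℝ → ℂ}, Continuous ψ → HasCompactSupport ψ → LocallyIntegrable u →
      ∫ x, ψ x * u x = (∫ x, (ψ x).re • u x) + Complex.I * ∫ x, (ψ x).im • u x := by
    intro ψ u hψ hψc hu
    have hre : Integrable fun x => (ψ x).re • u x :=
      hu.integrable_smul_left_of_hasCompactSupport (Complex.continuous_re.comp hψ)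
        (hψc.comp_left Complex.zero_re)
    have him : Integrable fun x => (ψ x).im • u x :=
      hu.integrable_smul_left_of_hasCompactSupport (Complex.continuous_im.comp hψ)
        (hψc.comp_left Complex.zero_im)
    rw [← integral_const_mul, ← integral_add hre (him.const_mul _)]
    refine integral_congr_ae (.of_forall fun x => ?_)
    conv_lhs => beta_reduce; rw [← Complex.re_add_im (ψ x)]
    simp only [Complex.real_smul]
    ring
  have hd : ∀ x, HasDerivAt φ (deriv φ x) x := fun x => (hφ.differentiable (by simp) x).hasDerivAt
  have hre' : deriv (fun x => (φ x).re) = fun x => (deriv φ x).re :=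
    funext fun x => (Complex.reCLM.hasFDerivAt.comp_hasDerivAt x (hd x)).deriv
  have him' : deriv (fun x => (φ x).im) = fun x => (deriv φ x).im :=
    funext fun x => (Complex.imCLM.hasFDerivAt.comp_hasDerivAt x (hd x)).deriv
  have hre := h (fun x => (φ x).re) (Complex.reCLM.contDiff.comp hφ) (hc.comp_left Complex.zero_re)
  have him := h (fun x => (φ x).im) (Complex.imCLM.contDiff.comp hφ) (hc.comp_left Complex.zero_im)
  rw [hre'] at hre
  rw [him'] at him
  rw [hsplit (hφ.continuous_deriv (by simp)) hc.deriv hg, hsplit hφ.continuous hc hg', hre, him]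
  ring

lemma HasWeakDerivative.smooth_mul {g g' K K' : ℝ → ℂ} (h : HasWeakDerivative g g')
    (hg : LocallyIntegrable g) (hg' : LocallyIntegrable g') (hK : ContDiff ℝ ∞ K)
    (hK' : ∀ x, HasDerivAt K (K' x) x) :
    HasWeakDerivative (fun x => K x * g x) (fun x => K x * g' x + K' x * g x) := by
  intro φ hφ hc
  have hφ' : ∀ x, HasDerivAt (fun x => φ x • K x) (φ x • K' x + deriv φ x • K x) x := fun x =>
    (hφ.differentiable (by simp) x).hasDerivAt.smul (hK' x)
  have hK'c : Continuous K' := by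
    rw [show K' = deriv K from funext fun x => (hK' x).deriv.symm]
    exact hK.continuous_deriv (by simp)
  have hint : ∀ {ψ u : ℝ → ℂ}, Continuous ψ → HasCompactSupport ψ → LocallyIntegrable u →
      Integrable fun x => ψ x * u x := fun hψ hψc hu =>
    hu.integrable_smul_left_of_hasCompactSupport hψ hψc
  have i1 := hint ((hφ.continuous_deriv (by simp)).smul hK.continuous) hc.deriv.smul_right hg
  have i2 := hint (hφ.continuous.smul hK'c) hc.smul_right hg
  have i3 := hint (hφ.continuous.smul hK.continuous) hc.smul_right hg'
  have key : ∫ x, deriv (fun x => φ x • K x) x * g x = -∫ x, φ x • K x * g' x :=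
    h.integral_deriv_mul hg hg' (hφ.smul hK) hc.smul_right
  calc ∫ x, deriv φ x • (K x * g x)
      = (∫ x, deriv (fun x => φ x • K x) x * g x) - ∫ x, (φ x • K' x) * g x := by
        simp only [fun x => (hφ' x).deriv, add_mul]
        rw [integral_add (by exact i2) (by exact i1), add_sub_cancel_left]
        simp only [smul_mul_assoc]
    _ = -∫ x, φ x • (K x * g' x + K' x * g x) := by
        simp only [smul_add, ← smul_mul_assoc]
        rw [integral_add (by exact i3) (by exact i2), neg_add', ← key]

lemma HasWeakDerivative.conj {g g' : ℝ → ℂ} (h : HasWeakDerivative g g') :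
    HasWeakDerivative (fun x => conj (g x)) (fun x => conj (g' x)) := by
  intro φ hφ hc
  have := congrArg conj (h φ hφ hc)
  rw [map_neg, ← integral_conj, ← integral_conj] at this
  simpa using this

lemma eq_zero_of_tendsto_atTop_of_integrableOn {E : Type*} [NormedAddCommGroup E] {g : ℝ → E}
    {s : ℝ} {l : E} (hi : IntegrableOn g (Ioi s)) (hg : Tendsto g atTop (𝓝 l)) : l = 0 :=
  IntegrableAtFilter.eq_zero_of_tendsto (μ := volume) ⟨Ioi s, Ioi_mem_atTop s, hi⟩ (fun t ht => by
    obtain ⟨b, hb⟩ := mem_atTop_sets.1 ht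
    exact top_unique (Real.volume_Ici (a := b) ▸ measure_mono hb)) hg

lemma HasWeakDerivative.integral_Ioi {g g' : ℝ → ℂ} (h : HasWeakDerivative g g')
    (hg : Continuous g) (hg' : LocallyIntegrable g') {s : ℝ} (hi : IntegrableOn g (Ioi s))
    (hi' : IntegrableOn g' (Ioi s)) : ∫ x in Ioi s, g' x = -g s := by
  have hlim := intervalIntegral_tendsto_integral_Ioi s hi' tendsto_id
  simp only [h.integral_eq_sub hg hg', id] at hlim
  have hg_lim : Tendsto g atTop (𝓝 ((∫ x in Ioi s, g' x) + g s)) := by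
    simpa using hlim.add_const (g s)
  exact eq_neg_of_add_eq_zero_left (eq_zero_of_tendsto_atTop_of_integrableOn hi hg_lim)

lemma HasWeakDerivative.integral_Iic {g g' : ℝ → ℂ} (h : HasWeakDerivative g g')
    (hg : Continuous g) (hg' : LocallyIntegrable g') {s : ℝ} (hi : IntegrableOn g (Iic s))
    (hi' : IntegrableOn g' (Iic s)) : ∫ x in Iic s, g' x = g s := by
  have hlim := intervalIntegral_tendsto_integral_Iic s hi' tendsto_id
  simp only [h.integral_eq_sub hg hg', id] at hlim
  have hg_lim : Tendsto g atBot (𝓝 (g s - ∫ x in Iic s, g' x)) := by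
    simpa using hlim.const_sub (g s)
  have hzero := IntegrableAtFilter.eq_zero_of_tendsto (μ := volume)
    ⟨Iic s, Iic_mem_atBot s, hi⟩ (fun t ht => by
      obtain ⟨b, hb⟩ := mem_atBot_sets.1 ht
      exact top_unique (Real.volume_Iic (a := b) ▸ measure_mono hb)) hg_lim
  exact (sub_eq_zero.1 hzero).symm

/-- `y` is a solution on the whole line of the Weber equation `-y'' + (x²/4 - 1/2) y = ν y`, with
derivative `y'`, such that `y`, `y'` and `x y` are square integrable on `T`. -/
structure IsWeberSolution (ν : ℂ) (y y' : ℝ → ℂ) (T : Set ℝ) : Prop where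
  hasDerivAt : ∀ x, HasDerivAt y (y' x) x
  hasDerivAt' : ∀ x : ℝ, HasDerivAt y' (((x : ℂ) ^ 2 / 4 - 1 / 2 - ν) * y x) x
  memLp : MemLp y 2 (volume.restrict T)
  memLp' : MemLp y' 2 (volume.restrict T)
  memLp_mul : MemLp (fun x : ℝ => (x : ℂ) * y x) 2 (volume.restrict T)

/-- The integrand of `⟨f', g'⟩ + ¼ ⟨x f, x g⟩ - (½ + ν) ⟨f, g⟩`, for a function `f` with derivative
`f'` that need not belong to the form domain. -/
def weberDensity (ν : ℂ) (f f' : ℝ → ℂ) (g : PCFormDomain) (x : ℝ) : ℂ :=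
  f' x * conj (g.wderiv x) + ((x : ℂ) ^ 2 / 4 - 1 / 2 - ν) * f x * conj (g.toFun x)

namespace IsWeberSolution

variable {ν : ℂ} {y y' : ℝ → ℂ} {s : ℝ} {T : Set ℝ}

lemma continuous (h : IsWeberSolution ν y y' T) : Continuous y :=
  continuous_iff_continuousAt.2 fun x => (h.hasDerivAt x).continuousAt

lemma continuous_deriv (h : IsWeberSolution ν y y' T) : Continuous y' :=
  continuous_iff_continuousAt.2 fun x => (h.hasDerivAt' x).continuousAt

lemma contDiff_deriv (h : IsWeberSolution ν y y' T) : ContDiff ℝ ∞ y' := by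
  have hy : deriv y = y' := funext fun x => (h.hasDerivAt x).deriv
  have hy' : deriv y' = fun x : ℝ => ((x : ℂ) ^ 2 / 4 - 1 / 2 - ν) * y x :=
    funext fun x => (h.hasDerivAt' x).deriv
  have hd : Differentiable ℝ y := fun x => (h.hasDerivAt x).differentiableAt
  have hd' : Differentiable ℝ y' := fun x => (h.hasDerivAt' x).differentiableAt
  have bootstrap : ∀ k : ℕ, ContDiff ℝ k y ∧ ContDiff ℝ k y' := by
    intro k
    induction k with
    | zero => exact ⟨contDiff_zero.2 h.continuous, contDiff_zero.2 h.continuous_deriv⟩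
    | succ k ih =>
      have hpoly : ContDiff ℝ k fun x : ℝ => (x : ℂ) ^ 2 / 4 - 1 / 2 - ν := by
        have : ContDiff ℝ k ((↑) : ℝ → ℂ) := Complex.ofRealCLM.contDiff
        fun_prop
      push_cast
      exact ⟨contDiff_succ_iff_deriv.2 ⟨hd, by simp, hy ▸ ih.2⟩,
        contDiff_succ_iff_deriv.2 ⟨hd', by simp, hy' ▸ hpoly.mul ih.1⟩⟩
  exact contDiff_infty.2 fun k => (bootstrap k).2

lemma const_mul (h : IsWeberSolution ν y y' T) (c : ℂ) :
    IsWeberSolution ν (fun x => c * y x) (fun x => c * y' x) T where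
  hasDerivAt x := (h.hasDerivAt x).const_mul c
  hasDerivAt' x := ((h.hasDerivAt' x).const_mul c).congr_deriv (mul_left_comm ..)
  memLp := h.memLp.const_mul c
  memLp' := h.memLp'.const_mul c
  memLp_mul := (h.memLp_mul.const_mul c).ae_eq (.of_forall fun _ => mul_left_comm ..)

lemma comp_neg (h : IsWeberSolution ν y y' (Ioi (-s))) :
    IsWeberSolution ν (fun x => y (-x)) (fun x => -y' (-x)) (Iic s) := by
  have hmp : MeasurePreserving (fun x : ℝ => -x) (volume.restrict (Iic s))
      (volume.restrict (Ioi (-s))) := by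
    have := (Measure.measurePreserving_neg (volume : Measure ℝ)).restrict_preimage
      (measurableSet_Ioi (a := -s))
    rwa [show (Neg.neg ⁻¹' Ioi (-s) : Set ℝ) = Iio s by ext; simp,
      Measure.restrict_congr_set Iio_ae_eq_Iic] at this
  refine ⟨fun x => ?_, fun x => ?_, h.memLp.comp_measurePreserving hmp,
    (h.memLp'.comp_measurePreserving hmp).neg, ?_⟩
  · exact ((h.hasDerivAt (-x)).scomp x (hasDerivAt_neg x)).congr_deriv (by simp)
  · exact ((h.hasDerivAt' (-x)).scomp x (hasDerivAt_neg x)).neg.congr_deriv (by simp)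
  · exact (h.memLp_mul.comp_measurePreserving hmp).neg.ae_eq (.of_forall fun x => by simp)

lemma integrableOn_weberDensity (h : IsWeberSolution ν y y' T) (g : PCFormDomain) :
    IntegrableOn (weberDensity ν y y' g) T := by
  have h₀ := h.memLp.integrable_mul (g.memLp_toFun.restrict T).star
  have h₁ := h.memLp'.integrable_mul (g.memLp_wderiv.restrict T).star
  have hx := h.memLp_mul.integrable_mul (g.memLp_mul.restrict T).star
  refine (h₁.add ((hx.const_mul (1 / 4)).sub (h₀.const_mul (1 / 2 + ν)))).congr
    (.of_forall fun x => ?_)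
  simp only [weberDensity, Pi.add_apply, Pi.sub_apply, Pi.mul_apply, Pi.star_apply,
    RCLike.star_def, map_mul, Complex.conj_ofReal]
  ring

lemma hasWeakDerivative_mul_conj (h : IsWeberSolution ν y y' T) (g : PCFormDomain) :
    HasWeakDerivative (fun x => y' x * conj (g.toFun x)) (weberDensity ν y y' g) :=
  g.hasWeakDerivative.conj.smooth_mul
    (g.memLp_toFun.star.locallyIntegrable (by norm_num))
    (g.memLp_wderiv.star.locallyIntegrable (by norm_num)) h.contDiff_deriv h.hasDerivAt'

lemma continuous_mul_conj (h : IsWeberSolution ν y y' T) (g : PCFormDomain) :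
    Continuous fun x => y' x * conj (g.toFun x) :=
  h.continuous_deriv.mul (Complex.continuous_conj.comp g.continuous_toFun)

lemma locallyIntegrable_weberDensity (h : IsWeberSolution ν y y' T) (g : PCFormDomain) :
    LocallyIntegrable (weberDensity ν y y' g) := by
  refine LocallyIntegrable.add ?_ (Continuous.locallyIntegrable ?_)
  · have := (g.memLp_wderiv.star.locallyIntegrable (by norm_num)).locallyIntegrableOn univ
    exact locallyIntegrableOn_univ.1
      (this.continuousOn_mul h.continuous_deriv.continuousOn isOpen_univ.isLocallyClosed)
  · have := h.continuous
    have : Continuous fun x => conj (g.toFun x) :=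
      Complex.continuous_conj.comp g.continuous_toFun
    fun_prop

lemma integral_Ioi_weberDensity (h : IsWeberSolution ν y y' (Ioi s)) (g : PCFormDomain) :
    ∫ x in Ioi s, weberDensity ν y y' g x = -(y' s * conj (g.toFun s)) :=
  (h.hasWeakDerivative_mul_conj g).integral_Ioi (h.continuous_mul_conj g)
    (h.locallyIntegrable_weberDensity g)
    (h.memLp'.integrable_mul (g.memLp_toFun.restrict _).star) (h.integrableOn_weberDensity g)

lemma integral_Iic_weberDensity (h : IsWeberSolution ν y y' (Iic s)) (g : PCFormDomain) :
    ∫ x in Iic s, weberDensity ν y y' g x = y' s * conj (g.toFun s) :=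
  (h.hasWeakDerivative_mul_conj g).integral_Iic (h.continuous_mul_conj g)
    (h.locallyIntegrable_weberDensity g)
    (h.memLp'.integrable_mul (g.memLp_toFun.restrict _).star) (h.integrableOn_weberDensity g)

end IsWeberSolution

lemma pcForm_eq_integral_weberDensity (z ν : ℂ) (b : ℝ) (f g : PCFormDomain) :
    pcForm z b f g = ν * (∫ x, f.toFun x * conj (g.toFun x))
      + (∫ x, weberDensity ν f.toFun f.wderiv g x)
      + z * (f.toFun b * conj (g.toFun b) - f.toFun (-b) * conj (g.toFun (-b))) := by
  have h₀ := integrable_mul_conj f.memLp_toFun g.memLp_toFun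
  have h₁ := integrable_mul_conj f.memLp_wderiv g.memLp_wderiv
  have hx := integrable_mul_conj f.memLp_mul g.memLp_mul
  have hdensity : weberDensity ν f.toFun f.wderiv g = fun x : ℝ =>
      f.wderiv x * conj (g.wderiv x)
        + (1 / 4 * ((x : ℂ) * f.toFun x * conj ((x : ℂ) * g.toFun x))
          - (1 / 2 + ν) * (f.toFun x * conj (g.toFun x))) := by
    funext x
    simp only [weberDensity, map_mul, Complex.conj_ofReal]
    ring
  rw [pcForm, hdensity, integral_add h₁ (by exact (hx.const_mul _).sub (h₀.const_mul _)),
    integral_sub (hx.const_mul _) (h₀.const_mul _), integral_const_mul, integral_const_mul]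
  ring

section Glue

variable {ν : ℂ} {s : ℝ} {R R' L L' : ℝ → ℂ}

open Classical in
lemma continuous_piecewise_Ioi (hR : Continuous R) (hL : Continuous L) (h : R s = L s) :
    Continuous ((Ioi s).piecewise R L) :=
  hR.piecewise (fun x hx => by
    rw [frontier_Ioi, mem_singleton_iff] at hx
    rw [hx, h]) hL

open Classical in
lemma hasDerivAt_piecewise_Ioi {x : ℝ} (hR : HasDerivAt R (R' x) x) (hL : HasDerivAt L (L' x) x)
    (hx : x ≠ s) : HasDerivAt ((Ioi s).piecewise R L) ((Ioi s).piecewise R' L' x) x := by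
  rcases lt_or_gt_of_ne hx with hxs | hxs
  · rw [piecewise_eq_of_notMem _ R' L' (notMem_Ioi.2 hxs.le)]
    refine hL.congr_of_eventuallyEq ?_
    filter_upwards [Iio_mem_nhds hxs] with t ht
    exact piecewise_eq_of_notMem _ _ _ (notMem_Ioi.2 (le_of_lt ht))
  · rw [piecewise_eq_of_mem _ R' L' (mem_Ioi.2 hxs)]
    refine hR.congr_of_eventuallyEq ?_
    filter_upwards [Ioi_mem_nhds hxs] with t ht
    exact piecewise_eq_of_mem _ _ _ ht

open Classical in
/-- The function equal to `L` on `(-∞, s]` and to `R` on `(s, ∞)`, where `L` and `R` are Weber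
solutions that are square integrable on these half-lines and agree at `s`. -/
def PCFormDomain.glue (hR : IsWeberSolution ν R R' (Ioi s)) (hL : IsWeberSolution ν L L' (Iic s))
    (h : R s = L s) : PCFormDomain where
  toFun := (Ioi s).piecewise R L
  wderiv := (Ioi s).piecewise R' L'
  continuous_toFun := continuous_piecewise_Ioi hR.continuous hL.continuous h
  hasWeakDerivative :=
    hasWeakDerivative_of_hasDerivAt_off_countable (countable_singleton s)
      (continuous_piecewise_Ioi hR.continuous hL.continuous h)
      (fun x hx => hasDerivAt_piecewise_Ioi (hR.hasDerivAt x) (hL.hasDerivAt x) hx)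
      ((hR.memLp'.piecewise measurableSet_Ioi
        (by rw [compl_Ioi]; exact hL.memLp')).locallyIntegrable (by norm_num))
  memLp_toFun := hR.memLp.piecewise measurableSet_Ioi (by rw [compl_Ioi]; exact hL.memLp)
  memLp_wderiv := hR.memLp'.piecewise measurableSet_Ioi (by rw [compl_Ioi]; exact hL.memLp')
  memLp_mul := by
    refine (hR.memLp_mul.piecewise measurableSet_Ioi (g := fun x : ℝ => (x : ℂ) * L x)
      (by rw [compl_Ioi]; exact hL.memLp_mul)).ae_eq (.of_forall fun x => ?_)
    by_cases hx : x ∈ Ioi s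
    · simp only [piecewise_eq_of_mem _ _ _ hx]
    · simp only [piecewise_eq_of_notMem _ _ _ hx]

variable (hR : IsWeberSolution ν R R' (Ioi s)) (hL : IsWeberSolution ν L L' (Iic s))
  (h : R s = L s)

lemma PCFormDomain.glue_of_lt {x : ℝ} (hx : s < x) : (glue hR hL h).toFun x = R x :=
  piecewise_eq_of_mem _ _ _ hx

lemma PCFormDomain.glue_of_le {x : ℝ} (hx : x ≤ s) : (glue hR hL h).toFun x = L x :=
  piecewise_eq_of_notMem _ _ _ (notMem_Ioi.2 hx)

lemma integral_weberDensity_glue (g : PCFormDomain) :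
    ∫ x, weberDensity ν (PCFormDomain.glue hR hL h).toFun (PCFormDomain.glue hR hL h).wderiv g x
      = (L' s - R' s) * conj (g.toFun s) := by
  set f := PCFormDomain.glue hR hL h
  have hIoi : EqOn (weberDensity ν f.toFun f.wderiv g) (weberDensity ν R R' g) (Ioi s) :=
    fun x hx => by
      rw [weberDensity, PCFormDomain.glue_of_lt hR hL h hx,
        show f.wderiv x = R' x from piecewise_eq_of_mem _ _ _ hx, weberDensity]
  have hIic : EqOn (weberDensity ν f.toFun f.wderiv g) (weberDensity ν L L' g) (Iic s) :=
    fun x hx => by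
      rw [weberDensity, PCFormDomain.glue_of_le hR hL h hx,
        show f.wderiv x = L' x from piecewise_eq_of_notMem _ _ _ (notMem_Ioi.2 hx), weberDensity]
  rw [← intervalIntegral.integral_Iic_add_Ioi
      ((integrableOn_congr_fun hIic measurableSet_Iic).2 (hL.integrableOn_weberDensity g))
      ((integrableOn_congr_fun hIoi measurableSet_Ioi).2 (hR.integrableOn_weberDensity g)),
    setIntegral_congr_fun measurableSet_Iic hIic, setIntegral_congr_fun measurableSet_Ioi hIoi,
    hL.integral_Iic_weberDensity, hR.integral_Ioi_weberDensity]
  ring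

end Glue

/-- The Wronskian at `s` of `y` and its reflection `x ↦ y (-x)`, where `y'` is the derivative of
`y`. -/
def reflectionWronskian (y y' : ℝ → ℂ) (s : ℝ) : ℂ :=
  y' s * y (-s) + y s * y' (-s)

section Green

variable {ν : ℂ} {y y' : ℝ → ℂ}

/-- The Green's function with pole `s` (times a Wronskian) built from a solution `y` that is square
integrable at `+∞` and its reflection. -/
def PCFormDomain.green (hy : ∀ c, IsWeberSolution ν y y' (Ioi c)) (s : ℝ) : PCFormDomain :=
  .glue ((hy s).const_mul (y (-s))) ((hy (-s)).comp_neg.const_mul (y s)) (mul_comm _ _)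

variable (hy : ∀ c, IsWeberSolution ν y y' (Ioi c)) {s x : ℝ}

lemma PCFormDomain.green_of_lt (hx : s < x) : (green hy s).toFun x = y (-s) * y x :=
  glue_of_lt _ _ _ hx

lemma PCFormDomain.green_of_le (hx : x ≤ s) : (green hy s).toFun x = y s * y (-x) :=
  glue_of_le _ _ _ hx

lemma pcForm_green (z : ℂ) (b s : ℝ) (g : PCFormDomain) :
    pcForm z b (.green hy s) g = ν * (∫ x, (PCFormDomain.green hy s).toFun x * conj (g.toFun x))
      - reflectionWronskian y y' s * conj (g.toFun s)
      + z * ((PCFormDomain.green hy s).toFun b * conj (g.toFun b)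
        - (PCFormDomain.green hy s).toFun (-b) * conj (g.toFun (-b))) := by
  rw [pcForm_eq_integral_weberDensity z ν, PCFormDomain.green, integral_weberDensity_glue,
    reflectionWronskian]
  ring

end Green

lemma isEigenvalue_pcOperator {z ν : ℂ} {b : ℝ} (f : PCFormDomain) (hne : f.toFun ≠ 0)
    (hf : ∀ g : PCFormDomain, pcForm z b f g = ν * ∫ x, f.toFun x * conj (g.toFun x)) :
    IsEigenvalue (pcOperator z b) ν := by
  set u := f.memLp_toFun.toLp f.toFun
  have hu : (u : ℝ → ℂ) =ᵐ[volume] f.toFun := f.memLp_toFun.coeFn_toLp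
  have hgraph : (u, ν • u) ∈ (pcOperator z b).graph := by
    rw [pcOperator_graph]
    refine ⟨f, hu, fun g => ?_⟩
    rw [hf, ← integral_const_mul]
    refine integral_congr_ae ?_
    filter_upwards [Lp.coeFn_smul ν u, hu] with x hνu hux
    rw [hνu, Pi.smul_apply, hux, smul_eq_mul, mul_assoc]
  obtain ⟨v, hv, hTv⟩ : ∃ v : (pcOperator z b).domain, (v : Lp ℂ 2 volume) = u ∧
    pcOperator z b v = ν • u := (LinearPMap.mem_graph_iff _).1 hgraph
  refine ⟨v, fun h₀ => hne ?_, by rw [hTv, hv]⟩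
  rw [← hv, h₀] at hu
  exact (Continuous.ae_eq_iff_eq volume f.continuous_toFun continuous_const).1
    (hu.symm.trans (Lp.coeFn_zero ℂ 2 volume))

lemma isEigenvalue_pcOperator_of_sq_reflectionWronskian_eq {z ν : ℂ} {b : ℝ} (hb : 0 < b)
    {y y' : ℝ → ℂ} (hy : ∀ c, IsWeberSolution ν y y' (Ioi c))
    (hw : reflectionWronskian y y' b ≠ 0)
    (hdet : reflectionWronskian y y' b ^ 2 = z ^ 2 * (y b ^ 2 * (y (-b) ^ 2 - y b ^ 2))) :
    IsEigenvalue (pcOperator z b) ν := by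
  set w := reflectionWronskian y y' b
  have hw_neg : reflectionWronskian y y' (-b) = w := by
    simp only [w, reflectionWronskian, neg_neg]; ring
  have hyb : y b ≠ 0 := fun h₀ => by simp [h₀, hw] at hdet
  set k := PCFormDomain.green hy b
  set l := PCFormDomain.green hy (-b)
  have hkb : k.toFun b = y b * y (-b) := PCFormDomain.green_of_le hy le_rfl
  have hkb' : k.toFun (-b) = y b * y b := by
    rw [PCFormDomain.green_of_le hy (by linarith), neg_neg]
  have hlb : l.toFun b = y b * y b := by
    rw [PCFormDomain.green_of_lt hy (by linarith), neg_neg]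
  have hlb' : l.toFun (-b) = y b * y (-b) := by
    rw [PCFormDomain.green_of_le hy le_rfl, neg_neg, mul_comm]
  -- `(P, Q)` is in the kernel of the `2 × 2` matrix of the matching conditions at `±b`.
  set P := z * (y b * y b) with hP
  set Q := w - z * (y b * y (-b)) with hQ
  have hf : ∀ x, ((k.smul P).add (l.smul Q)).toFun x = P * k.toFun x + Q * l.toFun x :=
    fun x => rfl
  refine isEigenvalue_pcOperator ((k.smul P).add (l.smul Q)) (fun h₀ => ?_) fun g => ?_
  · have h₀b := (hf b).symm.trans (congrFun h₀ b)
    refine mul_ne_zero (mul_ne_zero hyb hyb) hw ?_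
    rw [hkb, hlb, hP, hQ, Pi.zero_apply] at h₀b
    linear_combination h₀b
  · have hsplit : ∫ x, ((k.smul P).add (l.smul Q)).toFun x * conj (g.toFun x)
        = P * (∫ x, k.toFun x * conj (g.toFun x)) + Q * ∫ x, l.toFun x * conj (g.toFun x) := by
      simp only [hf, add_mul, mul_assoc]
      rw [integral_add ((integrable_mul_conj k.memLp_toFun g.memLp_toFun).const_mul P)
          ((integrable_mul_conj l.memLp_toFun g.memLp_toFun).const_mul Q),
        integral_const_mul, integral_const_mul]
    rw [pcForm_add, pcForm_smul, pcForm_smul, pcForm_green, pcForm_green, hsplit, hw_neg, hkb, hkb',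
      hlb, hlb', hP, hQ]
    linear_combination (-conj (g.toFun (-b))) * hdet

/-- The solution `e^{-x²/4} He_ν(x)` of the Weber equation that decays at `+∞`; as for
`complexHermite`, it is meant for `Re ν < k`. -/
def decayingWeber (k : ℕ) (ν : ℂ) (x : ℝ) : ℂ :=
  (Real.exp (-x ^ 2 / 4) : ℂ) * complexHermite k ν x

/-- The derivative in `x` of `decayingWeber k ν`. -/
def decayingWeberDeriv (k : ℕ) (ν : ℂ) (x : ℝ) : ℂ :=
  ν * decayingWeber k (ν - 1) x - x / 2 * decayingWeber k ν x

lemma hasDerivAt_exp_neg_sq_div_four (x : ℝ) :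
    HasDerivAt (fun x : ℝ => (Real.exp (-x ^ 2 / 4) : ℂ))
      (-(x / 2) * (Real.exp (-x ^ 2 / 4) : ℂ)) x := by
  have h : HasDerivAt (fun x : ℝ => -x ^ 2 / 4) (-(x / 2)) x :=
    (((hasDerivAt_id x).pow 2).neg.div_const 4).congr_deriv (by simp only [id]; ring)
  refine h.exp.ofReal_comp.congr_deriv ?_
  push_cast
  ring

lemma one_add_abs_pow_le (N : ℕ) (x : ℝ) :
    (1 + |x|) ^ N ≤ N.factorial * Real.exp 3 * Real.exp (x ^ 2 / 8) := by
  have hpow := Real.pow_div_factorial_le_exp (1 + |x|) (by positivity) N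
  rw [div_le_iff₀ (by positivity)] at hpow
  calc (1 + |x|) ^ N ≤ Real.exp (1 + |x|) * N.factorial := hpow
    _ ≤ Real.exp (3 + x ^ 2 / 8) * N.factorial :=
        mul_le_mul_of_nonneg_right
          (Real.exp_le_exp.2 (by nlinarith [sq_nonneg (|x| - 4), sq_abs x])) (by positivity)
    _ = N.factorial * Real.exp 3 * Real.exp (x ^ 2 / 8) := by rw [Real.exp_add]; ring

lemma norm_exp_neg_sq_mul_le {F : ℂ} {C : ℝ} {N : ℕ} {x : ℝ} (hC : 0 ≤ C)
    (hF : ‖F‖ ≤ C * (1 + |x|) ^ N) :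
    ‖(Real.exp (-x ^ 2 / 4) : ℂ) * F‖
      ≤ C * (N.factorial * Real.exp 3) * Real.exp (-(1 / 8) * x ^ 2) := by
  rw [norm_mul, Complex.norm_real, Real.norm_of_nonneg (Real.exp_pos _).le]
  calc Real.exp (-x ^ 2 / 4) * ‖F‖
      ≤ Real.exp (-x ^ 2 / 4) * (C * (N.factorial * Real.exp 3 * Real.exp (x ^ 2 / 8))) := by
        gcongr
        exact hF.trans (by gcongr; exact one_add_abs_pow_le N x)
    _ = C * (N.factorial * Real.exp 3) * Real.exp (-x ^ 2 / 4 + x ^ 2 / 8) := by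
        rw [Real.exp_add]; ring
    _ = C * (N.factorial * Real.exp 3) * Real.exp (-(1 / 8) * x ^ 2) := by ring_nf

lemma memLp_exp_neg_sq_mul {F : ℝ → ℂ} (hF : Continuous F) {c C : ℝ} {N : ℕ} (hC : 0 ≤ C)
    (hbound : ∀ x, c ≤ x → ‖F x‖ ≤ C * (1 + |x|) ^ N) :
    MemLp (fun x : ℝ => (Real.exp (-x ^ 2 / 4) : ℂ) * F x) 2 (volume.restrict (Ioi c)) := by
  have hgauss : MemLp (fun x : ℝ => Real.exp (-(1 / 8) * x ^ 2)) 2 := by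
    refine (memLp_two_iff_integrable_sq (by fun_prop)).2 ?_
    refine (integrable_exp_neg_mul_sq (b := 1 / 4) (by norm_num)).congr (.of_forall fun x => ?_)
    change Real.exp (-(1 / 4) * x ^ 2) = Real.exp (-(1 / 8) * x ^ 2) ^ 2
    rw [← Real.exp_nat_mul]
    ring_nf
  refine (hgauss.const_mul (C * (N.factorial * Real.exp 3))).restrict (Ioi c) |>.of_le
    (by fun_prop) ?_
  filter_upwards [ae_restrict_mem measurableSet_Ioi] with x hx
  exact (norm_exp_neg_sq_mul_le hC (hbound x (le_of_lt hx))).trans (le_abs_self _)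

lemma eventually_norm_decayingWeber_le {k : ℕ} {ν₀ : ℂ} (hν : ν₀.re < k) (c : ℝ) :
    ∃ C : ℝ, 0 ≤ C ∧ ∀ᶠ ν in 𝓝 ν₀, ∀ x, c ≤ x →
      ‖decayingWeber k ν x‖ ≤ C * Real.exp (-(1 / 8) * x ^ 2) := by
  obtain ⟨C, hC, hbound⟩ := eventually_norm_complexHermite_le k c hν
  refine ⟨C * (k.factorial * Real.exp 3), by positivity, ?_⟩
  filter_upwards [hbound] with ν hν x hx
  exact norm_exp_neg_sq_mul_le hC (hν x hx)

lemma continuous_complexHermite {k : ℕ} {ν : ℂ} (hν : ν.re < k) :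
    Continuous (complexHermite k ν) :=
  continuous_iff_continuousAt.2 fun x => (hasDerivAt_complexHermite k hν x).continuousAt

lemma memLp_decayingWeber {k : ℕ} {ν : ℂ} (hν : ν.re < k) (c : ℝ) :
    MemLp (decayingWeber k ν) 2 (volume.restrict (Ioi c)) := by
  obtain ⟨C, hC, hbound⟩ := eventually_norm_complexHermite_le k c hν
  exact memLp_exp_neg_sq_mul (continuous_complexHermite hν) hC hbound.self_of_nhds

lemma memLp_mul_decayingWeber {k : ℕ} {ν : ℂ} (hν : ν.re < k) (c : ℝ) :
    MemLp (fun x : ℝ => (x : ℂ) * decayingWeber k ν x) 2 (volume.restrict (Ioi c)) := by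
  obtain ⟨C, hC, hbound⟩ := eventually_norm_complexHermite_le k c hν
  refine (memLp_exp_neg_sq_mul (N := k + 1) (Complex.continuous_ofReal.mul
    (continuous_complexHermite hν)) hC fun x hx => ?_).ae_eq (.of_forall fun x => mul_left_comm ..)
  calc ‖(x : ℂ) * complexHermite k ν x‖ = |x| * ‖complexHermite k ν x‖ := by
        rw [norm_mul, Complex.norm_real, Real.norm_eq_abs]
    _ ≤ (1 + |x|) * (C * (1 + |x|) ^ k) := by
        gcongr
        · linarith
        · exact hbound.self_of_nhds x hx
    _ = C * (1 + |x|) ^ (k + 1) := by ring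

lemma hasDerivAt_decayingWeber {k : ℕ} {ν : ℂ} (hν : ν.re < k) (x : ℝ) :
    HasDerivAt (decayingWeber k ν) (decayingWeberDeriv k ν x) x := by
  refine ((hasDerivAt_exp_neg_sq_div_four x).mul (hasDerivAt_complexHermite k hν x)).congr_deriv ?_
  simp only [decayingWeberDeriv, decayingWeber]
  ring

lemma isWeberSolution_decayingWeber {k : ℕ} {ν : ℂ} (hν : ν.re < k) (c : ℝ) :
    IsWeberSolution ν (decayingWeber k ν) (decayingWeberDeriv k ν) (Ioi c) := by
  have hν' : (ν - 1).re < k := by simp; linarith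
  refine ⟨hasDerivAt_decayingWeber hν, fun x => ?_, memLp_decayingWeber hν c, ?_,
    memLp_mul_decayingWeber hν c⟩
  · refine (((hasDerivAt_decayingWeber hν' x).const_mul ν).sub
      (((hasDerivAt_id x).ofReal_comp.div_const 2).mul
        (hasDerivAt_decayingWeber hν x))).congr_deriv ?_
    have hrec := complexHermite_recurrence k hν x
    rw [show ν - 2 = ν - 1 - 1 by ring] at hrec
    simp only [decayingWeberDeriv, decayingWeber, id, Complex.ofReal_one]
    linear_combination (Real.exp (-x ^ 2 / 4) : ℂ) * ν * hrec
  · refine (((memLp_decayingWeber hν' c).const_mul ν).sub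
      ((memLp_mul_decayingWeber hν c).const_mul (1 / 2))).ae_eq (.of_forall fun x => ?_)
    simp only [decayingWeberDeriv, Pi.sub_apply]
    ring

lemma IsWeberSolution.lagrange_identity {μ ν : ℂ} {y y' u u' : ℝ → ℂ} {c : ℝ}
    (hy : IsWeberSolution ν y y' (Ioi c)) (hu : IsWeberSolution μ u u' (Ioi c)) :
    y' c * u c - y c * u' c = (ν - μ) * ∫ x in Ioi c, y x * u x := by
  have hd : ∀ x, HasDerivAt (fun x => y' x * u x - y x * u' x) ((μ - ν) * (y x * u x)) x :=
    fun x => (((hy.hasDerivAt' x).mul (hu.hasDerivAt x)).sub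
      ((hy.hasDerivAt x).mul (hu.hasDerivAt' x))).congr_deriv (by ring)
  have hi : IntegrableOn (fun x => (μ - ν) * (y x * u x)) (Ioi c) :=
    (hy.memLp.integrable_mul hu.memLp).const_mul _
  have hwronskian : IntegrableOn (fun x => y' x * u x - y x * u' x) (Ioi c) :=
    (hy.memLp'.integrable_mul hu.memLp).sub (hy.memLp.integrable_mul hu.memLp')
  have hFTC := integral_Ioi_of_hasDerivAt_of_tendsto' (fun x _ => hd x) hi
    (tendsto_zero_of_hasDerivAt_of_integrableOn_Ioi (fun x _ => hd x) hi hwronskian)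
  rw [integral_const_mul] at hFTC
  linear_combination hFTC

lemma differentiableAt_decayingWeber_left {k : ℕ} {ν : ℂ} (hν : ν.re < k) (x : ℝ) :
    DifferentiableAt ℂ (fun ν => decayingWeber k ν x) ν :=
  (differentiableAt_complexHermite_left k hν x).const_mul _

lemma differentiableAt_decayingWeberDeriv_left {k : ℕ} {ν : ℂ} (hν : ν.re < k) (x : ℝ) :
    DifferentiableAt ℂ (fun ν => decayingWeberDeriv k ν x) ν := by
  have hν' : (ν - 1).re < k := by simp; linarith
  have hshift : DifferentiableAt ℂ (fun ν => decayingWeber k (ν - 1) x) ν :=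
    (differentiableAt_decayingWeber_left hν' x).comp ν (f := fun ν => ν - 1) (by fun_prop)
  exact (differentiableAt_id.mul hshift).sub
    ((differentiableAt_decayingWeber_left hν x).const_mul _)

lemma eventually_re_lt {μ : ℂ} {a : ℝ} (hμ : μ.re < a) : ∀ᶠ ν : ℂ in 𝓝 μ, ν.re < a :=
  Complex.continuous_re.continuousAt.eventually_lt_const hμ

lemma continuousAt_integral_decayingWeber_mul {k : ℕ} {μ : ℂ} (hμ : μ.re < k) (c : ℝ) :
    ContinuousAt (fun ν => ∫ x in Ioi c, decayingWeber k ν x * decayingWeber k μ x) μ := by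
  obtain ⟨C, hC, hbound⟩ := eventually_norm_decayingWeber_le hμ c
  refine continuousAt_of_dominated (bound := fun x => C * C * Real.exp (-(1 / 4) * x ^ 2))
    ?_ ?_ ((integrable_exp_neg_mul_sq (by norm_num)).const_mul _).integrableOn
    (.of_forall fun x =>
      (differentiableAt_decayingWeber_left hμ x).continuousAt.mul continuousAt_const)
  · filter_upwards [eventually_re_lt hμ] with ν hν
    exact (memLp_decayingWeber hν c).aestronglyMeasurable.mul
      (memLp_decayingWeber hμ c).aestronglyMeasurable
  · filter_upwards [hbound] with ν hν
    filter_upwards [ae_restrict_mem measurableSet_Ioi] with x hx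
    have hx : c ≤ x := le_of_lt hx
    calc ‖decayingWeber k ν x * decayingWeber k μ x‖
        ≤ (C * Real.exp (-(1 / 8) * x ^ 2)) * (C * Real.exp (-(1 / 8) * x ^ 2)) := by
          rw [norm_mul]
          gcongr
          exacts [hν x hx, hbound.self_of_nhds x hx]
      _ = C * C * Real.exp (-(1 / 8) * x ^ 2 + -(1 / 8) * x ^ 2) := by rw [Real.exp_add]; ring
      _ = C * C * Real.exp (-(1 / 4) * x ^ 2) := by ring_nf

lemma deriv_decayingWeber_left_mul {k : ℕ} {μ : ℂ} (hμ : μ.re < k) {c : ℝ}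
    (hc : decayingWeber k μ c = 0) :
    deriv (fun ν => decayingWeber k ν c) μ * decayingWeberDeriv k μ c
      = -∫ x in Ioi c, decayingWeber k μ x * decayingWeber k μ x := by
  have hslope := hasDerivAt_iff_tendsto_slope.1
    (differentiableAt_decayingWeber_left hμ c).hasDerivAt
  refine tendsto_nhds_unique (hslope.mul_const (decayingWeberDeriv k μ c)) ?_
  refine ((continuousAt_integral_decayingWeber_mul hμ c).tendsto.neg.mono_left
    nhdsWithin_le_nhds).congr' ?_
  filter_upwards [nhdsWithin_le_nhds (eventually_re_lt hμ), self_mem_nhdsWithin] with ν hν hne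
  have hlagrange := (isWeberSolution_decayingWeber hν c).lagrange_identity
    (isWeberSolution_decayingWeber hμ c)
  have hne : ν - μ ≠ 0 := sub_ne_zero.2 hne
  rw [hc] at hlagrange
  rw [slope_def_field, hc]
  field_simp
  linear_combination hlagrange

section Hermite

open Polynomial

lemma hermite_comp_neg_X (n : ℕ) : (hermite n).comp (-X) = C ((-1) ^ n) * hermite n := by
  induction n with
  | zero => simp
  | succ n ih =>
    have hd := congrArg derivative ih
    rw [derivative_comp, derivative_C_mul, derivative_neg, derivative_X] at hd
    rw [hermite_succ, sub_comp, mul_comp, X_comp, ih, pow_succ, C_mul, map_neg, map_one]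
    linear_combination hd

/-- The harmonic oscillator eigenfunction `e^{-x²/4} He_n(x)`, not normalised. -/
def hermiteFun (n : ℕ) (x : ℝ) : ℝ :=
  Real.exp (-x ^ 2 / 4) * aeval x (hermite n)

lemma hermiteFun_neg (n : ℕ) (x : ℝ) : hermiteFun n (-x) = (-1) ^ n * hermiteFun n x := by
  have haeval : aeval (-x) (hermite n) = (-1) ^ n * aeval x (hermite n) := by
    simpa [aeval_comp] using congrArg (aeval x) (hermite_comp_neg_X n)
  rw [hermiteFun, hermiteFun, haeval, neg_sq]
  ring

lemma differentiable_hermiteFun (n : ℕ) : Differentiable ℝ (hermiteFun n) := by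
  have := (hermite n).differentiable_aeval (𝕜 := ℝ)
  unfold hermiteFun
  fun_prop

lemma deriv_hermiteFun_neg (n : ℕ) (x : ℝ) :
    deriv (hermiteFun n) (-x) = -((-1) ^ n * deriv (hermiteFun n) x) := by
  have h := congrArg (deriv · x) (funext (hermiteFun_neg n))
  simp only [deriv_comp_neg, deriv_const_mul _ (differentiable_hermiteFun n x)] at h
  rw [← h, neg_neg]

lemma decayingWeber_natCast {n k : ℕ} (hk : n < k) (x : ℝ) :
    decayingWeber k n x = hermiteFun n x := by
  rw [decayingWeber, complexHermite_natCast hk, hermiteFun, Complex.ofReal_mul]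

lemma decayingWeberDeriv_natCast {n k : ℕ} (hk : n < k) (x : ℝ) :
    decayingWeberDeriv k n x = (deriv (hermiteFun n) x : ℝ) := by
  have h := hasDerivAt_decayingWeber (k := k) (ν := n) (by simpa using hk) x
  rw [funext (decayingWeber_natCast hk)] at h
  exact h.unique (differentiable_hermiteFun n x).hasDerivAt.ofReal_comp

lemma integrableOn_hermiteFun_sq (n : ℕ) (c : ℝ) :
    IntegrableOn (fun x => hermiteFun n x ^ 2) (Ioi c) := by
  have h := memLp_decayingWeber (k := n + 1) (ν := n) (by simp) c
  refine ((memLp_two_iff_integrable_sq_norm h.aestronglyMeasurable).1 h).congr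
    (.of_forall fun x => ?_)
  simp only [decayingWeber_natCast n.lt_succ_self, Complex.norm_real, Real.norm_eq_abs, sq_abs]

lemma intervalIntegral_hermiteFun_sq_pos (n : ℕ) {c d : ℝ} (hcd : c < d) :
    0 < ∫ x in c..d, hermiteFun n x ^ 2 := by
  refine intervalIntegral.integral_pos hcd
    ((differentiable_hermiteFun n).continuous.pow 2).continuousOn (fun x _ => sq_nonneg _) ?_
  by_contra! hcon
  refine map_monic_ne_zero (f := Int.castRingHom ℝ) (hermite_monic n)
    (eq_zero_of_infinite_isRoot _ ((Icc_infinite hcd).mono fun x hx => ?_))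
  have hx0 : hermiteFun n x = 0 :=
    pow_eq_zero_iff two_ne_zero |>.1 ((hcon x hx).antisymm (sq_nonneg _))
  rw [hermiteFun, mul_eq_zero, or_iff_right (Real.exp_pos _).ne'] at hx0
  rw [mem_ofPred_eq, IsRoot, eval_map]
  simpa [aeval_def] using hx0

lemma integral_hermiteFun_sq_lt (n : ℕ) {c d : ℝ} (hcd : c < d) :
    ∫ x in Ioi d, hermiteFun n x ^ 2 < ∫ x in Ioi c, hermiteFun n x ^ 2 := by
  rw [← intervalIntegral.integral_interval_add_Ioi (integrableOn_hermiteFun_sq n c)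
    (integrableOn_hermiteFun_sq n d)]
  exact lt_add_of_pos_left _ (intervalIntegral_hermiteFun_sq_pos n hcd)

lemma integral_hermiteFun_sq_pos (n : ℕ) (c : ℝ) : 0 < ∫ x in Ioi c, hermiteFun n x ^ 2 :=
  (integral_nonneg fun _ => sq_nonneg _).trans_lt (integral_hermiteFun_sq_lt n (lt_add_one c))

lemma deriv_decayingWeber_natCast_mul {n k : ℕ} (hk : n < k) {c : ℝ} (hc : hermiteFun n c = 0) :
    deriv (fun ν => decayingWeber k ν c) n * (deriv (hermiteFun n) c : ℝ)
      = -(∫ x in Ioi c, hermiteFun n x ^ 2 : ℝ) := by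
  have hyc : decayingWeber k n c = 0 := by rw [decayingWeber_natCast hk, hc, Complex.ofReal_zero]
  rw [← decayingWeberDeriv_natCast hk, deriv_decayingWeber_left_mul (by simpa using hk) hyc,
    ← integral_complex_ofReal]
  simp only [decayingWeber_natCast hk, sq, Complex.ofReal_mul]

end Hermite

lemma eventually_exists_eq_ofReal_mul_I {κ : ℂ → ℂ} {x₀ Q : ℝ} (hQ : 0 < Q)
    (hκ : HasStrictDerivAt κ (Q : ℂ) x₀) (h0 : κ x₀ = 0) {p : ℂ → Prop}
    (hp : ∀ᶠ ν in 𝓝 (x₀ : ℂ), p ν) :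
    ∀ᶠ t : ℝ in 𝓝[≠] 0, ∃ ν, p ν ∧ κ ν = t * Complex.I ∧ 0 < t * ν.im := by
  have hQ' : (Q : ℂ) ≠ 0 := mod_cast hQ.ne'
  set φ := hκ.localInverse κ Q x₀ hQ'
  have hφ0 : φ 0 = x₀ := h0 ▸ (hκ.eventually_left_inverse hQ').self_of_nhds
  have hφ : HasDerivAt φ (Q : ℂ)⁻¹ 0 := h0 ▸ (hκ.to_localInverse hQ').hasDerivAt
  have hκφ : ∀ᶠ w in 𝓝 0, κ (φ w) = w := h0 ▸ hκ.eventually_right_inverse hQ'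
  have hpφ : ∀ᶠ w in 𝓝 0, p (φ w) := hφ.continuousAt.eventually (by rwa [hφ0])
  have haxis : Tendsto (fun t : ℝ => (t : ℂ) * Complex.I) (𝓝[≠] 0) (𝓝 0) :=
    ((Complex.continuous_ofReal.mul continuous_const).tendsto' 0 0 (by simp)).mono_left
      nhdsWithin_le_nhds
  have him : HasDerivAt (fun t : ℝ => (φ (t * Complex.I)).im) Q⁻¹ 0 := by
    have hline : HasDerivAt (fun t : ℝ => (t : ℂ) * Complex.I) Complex.I 0 := by
      simpa using (hasDerivAt_id (0 : ℝ)).ofReal_comp.mul_const Complex.I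
    have hφ' : HasDerivAt φ (Q : ℂ)⁻¹ (((0 : ℝ) : ℂ) * Complex.I) := by simpa using hφ
    have h := hφ'.scomp (0 : ℝ) hline
    exact (Complex.imCLM.hasFDerivAt.comp_hasDerivAt (0 : ℝ) h).congr_deriv
      (by simp [← Complex.ofReal_inv])
  have hslope := (hasDerivAt_iff_tendsto_slope.1 him).eventually_const_lt (inv_pos.2 hQ)
  filter_upwards [hslope, haxis.eventually hκφ, haxis.eventually hpφ, self_mem_nhdsWithin]
    with t ht hκt hpt ht0
  refine ⟨φ (t * Complex.I), hpt, hκt, ?_⟩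
  have hslope_eq : t * (φ (t * Complex.I)).im
      = t ^ 2 * slope (fun t : ℝ => (φ (t * Complex.I)).im) 0 t := by
    have : t ≠ 0 := ht0
    simp only [slope_def_field, Complex.ofReal_zero, zero_mul, hφ0, Complex.ofReal_im, sub_zero]
    field_simp
  exact hslope_eq ▸ mul_pos (sq_pos_of_ne_zero ht0) ht

lemma exists_hasStrictDerivAt_sq_eq {g : ℂ → ℂ} {x₀ q : ℝ} (hg : AnalyticAt ℂ g x₀)
    (hq : 0 < q) (hgq : g x₀ = q) :
    ∃ κ : ℂ → ℂ, ∃ Q : ℝ, 0 < Q ∧ HasStrictDerivAt κ (Q : ℂ) x₀ ∧ κ x₀ = 0 ∧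
      ∀ ν, κ ν ^ 2 = (ν - x₀) ^ 2 * g ν := by
  have hslit : g x₀ ∈ Complex.slitPlane := hgq ▸ Complex.ofReal_mem_slitPlane.2 hq
  have hroot : AnalyticAt ℂ (fun ν => g ν ^ ((2 : ℕ) : ℂ)⁻¹) x₀ := hg.cpow analyticAt_const hslit
  refine ⟨fun ν => (ν - x₀) * g ν ^ ((2 : ℕ) : ℂ)⁻¹, q ^ ((2 : ℕ) : ℝ)⁻¹,
    Real.rpow_pos_of_pos hq _, ?_, by simp, fun ν => ?_⟩
  · have hsub : HasStrictDerivAt (fun ν : ℂ => ν - x₀) 1 x₀ :=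
      (hasStrictDerivAt_id (x₀ : ℂ)).sub_const (x₀ : ℂ)
    refine (hsub.mul hroot.hasStrictDerivAt).congr_deriv ?_
    simp only [sub_self, zero_mul, add_zero, one_mul, hgq, Complex.ofReal_cpow hq.le,
      Complex.ofReal_inv, Complex.ofReal_natCast]
  · rw [mul_pow, Complex.cpow_nat_inv_pow _ two_ne_zero]

lemma eventually_exists_nonreal_roots {g : ℂ → ℂ} {x₀ q : ℝ} (hg : AnalyticAt ℂ g x₀)
    (hq : 0 < q) (hgq : g x₀ = q) {p : ℂ → Prop} (hp : ∀ᶠ ν in 𝓝 (x₀ : ℂ), p ν) :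
    ∀ᶠ r : ℝ in atTop, ∃ ν₁ ν₂ : ℂ, 0 < ν₁.im ∧ ν₂.im < 0 ∧
      (p ν₁ ∧ (r : ℂ) ^ 2 * ((ν₁ - x₀) ^ 2 * g ν₁) = -1) ∧
      (p ν₂ ∧ (r : ℂ) ^ 2 * ((ν₂ - x₀) ^ 2 * g ν₂) = -1) := by
  obtain ⟨κ, Q, hQ, hκ, hκ0, hκsq⟩ := exists_hasStrictDerivAt_sq_eq hg hq hgq
  have hroots := eventually_exists_eq_ofReal_mul_I hQ hκ hκ0 hp
  have hpos : Tendsto (fun r : ℝ => r⁻¹) atTop (𝓝[≠] 0) :=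
    tendsto_inv_atTop_nhdsGT_zero.mono_right (nhdsGT_le_nhdsNE 0)
  have hneg : Tendsto (fun r : ℝ => (-r)⁻¹) atTop (𝓝[≠] 0) :=
    (tendsto_inv_atBot_nhdsLT_zero.mono_right (nhdsLT_le_nhdsNE 0)).comp tendsto_neg_atTop_atBot
  filter_upwards [hpos.eventually hroots, hneg.eventually hroots, eventually_gt_atTop 0]
    with r ⟨ν₁, hp₁, hκ₁, him₁⟩ ⟨ν₂, hp₂, hκ₂, him₂⟩ hr
  have hr' : (r : ℂ) ≠ 0 := mod_cast hr.ne'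
  refine ⟨ν₁, ν₂, pos_of_mul_pos_right him₁ (inv_pos.2 hr).le, ?_, ⟨hp₁, ?_⟩, hp₂, ?_⟩
  · exact neg_of_mul_pos_right him₂ (inv_lt_zero.2 (neg_neg_of_pos hr)).le
  · rw [← hκsq, hκ₁, mul_pow, Complex.I_sq]
    push_cast
    field_simp
  · rw [← hκsq, hκ₂, mul_pow, Complex.I_sq]
    push_cast
    field_simp

/-- The quotient `y_ν(x) / (ν - n)` of the decaying solution `y_ν` at a zero `x` of the Hermite
function `y_n`, extended analytically to `ν = n`. -/
def weberQuotient (n : ℕ) (x : ℝ) : ℂ → ℂ :=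
  dslope (fun ν => decayingWeber (n + 1) ν x) n

/-- The quotient of the reflection Wronskian of the decaying solution at `b` by `ν - n`, when
`± b` are zeros of the Hermite function of order `n`. -/
def wronskianQuotient (n : ℕ) (b : ℝ) (ν : ℂ) : ℂ :=
  decayingWeberDeriv (n + 1) ν b * weberQuotient n (-b) ν
    + weberQuotient n b ν * decayingWeberDeriv (n + 1) ν (-b)

/-- The function `g` for which the matching condition of `L_{z,b}` at `ν ≠ n` reads
`z² (ν - n)² g(ν) = 1`, when `± b` are zeros of the Hermite function of order `n`. -/
def matchingFun (n : ℕ) (b : ℝ) (ν : ℂ) : ℂ :=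
  weberQuotient n b ν ^ 2 * (weberQuotient n (-b) ν ^ 2 - weberQuotient n b ν ^ 2)
    / wronskianQuotient n b ν ^ 2

section Matching
variable {n : ℕ} {b x : ℝ} {ν : ℂ}

lemma decayingWeber_eq_mul_weberQuotient (hx : hermiteFun n x = 0) (ν : ℂ) :
    decayingWeber (n + 1) ν x = (ν - n) * weberQuotient n x ν := by
  have h := sub_smul_dslope (fun ν => decayingWeber (n + 1) ν x) (n : ℂ) ν
  rw [decayingWeber_natCast n.lt_succ_self, hx, Complex.ofReal_zero, sub_zero] at h
  exact h.symm

lemma hermiteFun_neg_eq_zero (hx : hermiteFun n x = 0) : hermiteFun n (-x) = 0 := by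
  rw [hermiteFun_neg, hx, mul_zero]

lemma reflectionWronskian_decayingWeber (hb : hermiteFun n b = 0) (ν : ℂ) :
    reflectionWronskian (decayingWeber (n + 1) ν) (decayingWeberDeriv (n + 1) ν) b
      = (ν - n) * wronskianQuotient n b ν := by
  rw [reflectionWronskian, wronskianQuotient, decayingWeber_eq_mul_weberQuotient hb,
    decayingWeber_eq_mul_weberQuotient (hermiteFun_neg_eq_zero hb)]
  ring

lemma setOf_re_lt_mem_nhds_natCast (n : ℕ) : {ν : ℂ | ν.re < (n + 1 : ℕ)} ∈ 𝓝 (n : ℂ) :=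
  eventually_re_lt (by simp)

lemma analyticAt_weberQuotient (n : ℕ) (x : ℝ) : AnalyticAt ℂ (weberQuotient n x) n :=
  ((Complex.differentiableOn_dslope (setOf_re_lt_mem_nhds_natCast n)).2 fun _ hν =>
    (differentiableAt_decayingWeber_left hν x).differentiableWithinAt).analyticAt
      (setOf_re_lt_mem_nhds_natCast n)

lemma analyticAt_decayingWeberDeriv_left (n : ℕ) (x : ℝ) :
    AnalyticAt ℂ (fun ν => decayingWeberDeriv (n + 1) ν x) n :=
  DifferentiableOn.analyticAt
    (fun _ hν => (differentiableAt_decayingWeberDeriv_left hν x).differentiableWithinAt)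
    (setOf_re_lt_mem_nhds_natCast n)

lemma analyticAt_wronskianQuotient (n : ℕ) (b : ℝ) : AnalyticAt ℂ (wronskianQuotient n b) n :=
  ((analyticAt_decayingWeberDeriv_left n b).mul (analyticAt_weberQuotient n (-b))).add
    ((analyticAt_weberQuotient n b).mul (analyticAt_decayingWeberDeriv_left n (-b)))

lemma deriv_hermiteFun_ne_zero (hx : hermiteFun n x = 0) : deriv (hermiteFun n) x ≠ 0 := by
  intro h
  have hlagrange := deriv_decayingWeber_natCast_mul n.lt_succ_self hx
  rw [h, Complex.ofReal_zero, mul_zero, zero_eq_neg, Complex.ofReal_eq_zero] at hlagrange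
  exact (integral_hermiteFun_sq_pos n x).ne' hlagrange

lemma weberQuotient_natCast (hx : hermiteFun n x = 0) :
    weberQuotient n x n
      = (-(∫ t in Ioi x, hermiteFun n t ^ 2) / deriv (hermiteFun n) x : ℝ) := by
  have hd : ((deriv (hermiteFun n) x : ℝ) : ℂ) ≠ 0 := mod_cast deriv_hermiteFun_ne_zero hx
  rw [weberQuotient, dslope_same, Complex.ofReal_div, Complex.ofReal_neg, eq_div_iff hd]
  exact deriv_decayingWeber_natCast_mul n.lt_succ_self hx

lemma weberQuotient_neg_natCast (hb : hermiteFun n b = 0) :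
    weberQuotient n (-b) n
      = ((-1) ^ n * ((∫ t in Ioi (-b), hermiteFun n t ^ 2) / deriv (hermiteFun n) b) : ℝ) := by
  rw [weberQuotient_natCast (hermiteFun_neg_eq_zero hb), deriv_hermiteFun_neg, neg_div_neg_eq]
  obtain h | h := neg_one_pow_eq_or ℝ n <;> simp only [h, one_mul, neg_one_mul, div_neg]

lemma wronskianQuotient_natCast (hb : hermiteFun n b = 0) :
    wronskianQuotient n b n = ((-1) ^ n *
      ((∫ t in Ioi b, hermiteFun n t ^ 2) + ∫ t in Ioi (-b), hermiteFun n t ^ 2) : ℝ) := by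
  have hd := deriv_hermiteFun_ne_zero hb
  rw [wronskianQuotient, weberQuotient_natCast hb, weberQuotient_neg_natCast hb,
    decayingWeberDeriv_natCast n.lt_succ_self, decayingWeberDeriv_natCast n.lt_succ_self,
    deriv_hermiteFun_neg, ← Complex.ofReal_mul, ← Complex.ofReal_mul, ← Complex.ofReal_add]
  congr 1
  field_simp
  ring

lemma wronskianQuotient_natCast_ne_zero (hb : hermiteFun n b = 0) :
    wronskianQuotient n b n ≠ 0 := by
  rw [wronskianQuotient_natCast hb, Complex.ofReal_ne_zero]
  exact mul_ne_zero (pow_ne_zero n (by norm_num))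
    (add_pos (integral_hermiteFun_sq_pos n b) (integral_hermiteFun_sq_pos n (-b))).ne'

lemma analyticAt_matchingFun (hb : hermiteFun n b = 0) : AnalyticAt ℂ (matchingFun n b) n :=
  (((analyticAt_weberQuotient n b).pow 2).mul
    (((analyticAt_weberQuotient n (-b)).pow 2).sub ((analyticAt_weberQuotient n b).pow 2))).div
      ((analyticAt_wronskianQuotient n b).pow 2)
      (pow_ne_zero 2 (wronskianQuotient_natCast_ne_zero hb))

lemma exists_pos_matchingFun_natCast_eq (hb0 : 0 < b) (hb : hermiteFun n b = 0) :
    ∃ q : ℝ, 0 < q ∧ matchingFun n b n = q := by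
  have hd := deriv_hermiteFun_ne_zero hb
  have hpos := integral_hermiteFun_sq_pos n b
  have hlt := integral_hermiteFun_sq_lt n (show -b < b by linarith)
  rw [matchingFun, weberQuotient_natCast hb, weberQuotient_neg_natCast hb,
    wronskianQuotient_natCast hb]
  set d := deriv (hermiteFun n) b
  set I₁ := ∫ t in Ioi b, hermiteFun n t ^ 2
  set I₂ := ∫ t in Ioi (-b), hermiteFun n t ^ 2
  have : 0 < I₂ ^ 2 - I₁ ^ 2 := by nlinarith
  have : 0 < I₁ + I₂ := by linarith
  refine ⟨(I₁ / d) ^ 2 * ((I₂ ^ 2 - I₁ ^ 2) / d ^ 2) / (I₁ + I₂) ^ 2, by positivity, ?_⟩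
  obtain h | h := neg_one_pow_eq_or ℝ n <;> rw [h] <;> push_cast <;> ring

lemma isEigenvalue_pcOperator_of_mul_matchingFun_eq (hb0 : 0 < b) (hb : hermiteFun n b = 0)
    (hre : ν.re < (n + 1 : ℕ)) (hν : ν ≠ n) (hw : wronskianQuotient n b ν ≠ 0) {z : ℂ}
    (h : z ^ 2 * ((ν - n) ^ 2 * matchingFun n b ν) = 1) : IsEigenvalue (pcOperator z b) ν := by
  refine isEigenvalue_pcOperator_of_sq_reflectionWronskian_eq hb0
    (isWeberSolution_decayingWeber hre) ?_ ?_
  · rw [reflectionWronskian_decayingWeber hb]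
    exact mul_ne_zero (sub_ne_zero.2 hν) hw
  · rw [reflectionWronskian_decayingWeber hb, decayingWeber_eq_mul_weberQuotient hb,
      decayingWeber_eq_mul_weberQuotient (hermiteFun_neg_eq_zero hb)]
    rw [matchingFun] at h
    field_simp at h
    linear_combination (-(ν - n) ^ 2) * h

lemma eventually_exists_nonreal_eigenvalues (hb0 : 0 < b) (hb : hermiteFun n b = 0) {ρ : ℝ}
    (hρ : 0 < ρ) :
    ∀ᶠ r : ℝ in atTop, ∃ ν₁ ν₂ : ℂ, 0 < ν₁.im ∧ ν₂.im < 0 ∧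
      (‖ν₁ - n‖ < ρ ∧ IsEigenvalue (pcOperator (Complex.I * r) b) ν₁) ∧
      (‖ν₂ - n‖ < ρ ∧ IsEigenvalue (pcOperator (Complex.I * r) b) ν₂) := by
  obtain ⟨q, hq, hgq⟩ := exists_pos_matchingFun_natCast_eq hb0 hb
  have hnear : ∀ᶠ ν : ℂ in 𝓝 (n : ℂ),
      ‖ν - n‖ < ρ ∧ ν.re < (n + 1 : ℕ) ∧ wronskianQuotient n b ν ≠ 0 :=
    (eventually_norm_sub_lt _ hρ).and <| (eventually_re_lt (by simp)).and <|
      (analyticAt_wronskianQuotient n b).continuousAt.eventually_ne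
        (wronskianQuotient_natCast_ne_zero hb)
  have hroots := eventually_exists_nonreal_roots (g := matchingFun n b) (x₀ := n) (q := q)
  simp only [Complex.ofReal_natCast] at hroots
  filter_upwards [hroots (analyticAt_matchingFun hb) hq hgq hnear] with r
    ⟨ν₁, ν₂, him₁, him₂, ⟨⟨hρ₁, hre₁, hw₁⟩, hr₁⟩, ⟨hρ₂, hre₂, hw₂⟩, hr₂⟩
  have ne_natCast : ∀ {ν : ℂ}, ν.im ≠ 0 → ν ≠ n := by
    rintro _ him rfl
    exact him (Complex.natCast_im n)
  have sq_eq : ∀ {s : ℂ}, (r : ℂ) ^ 2 * s = -1 → (Complex.I * r) ^ 2 * s = 1 := by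
    intro s hs
    rw [mul_pow, Complex.I_sq, mul_assoc, hs]
    ring
  exact ⟨ν₁, ν₂, him₁, him₂,
    ⟨hρ₁, isEigenvalue_pcOperator_of_mul_matchingFun_eq hb0 hb hre₁ (ne_natCast him₁.ne') hw₁
      (sq_eq hr₁)⟩,
    hρ₂, isEigenvalue_pcOperator_of_mul_matchingFun_eq hb0 hb hre₂ (ne_natCast him₂.ne) hw₂
      (sq_eq hr₂)⟩

end Matching

section HermiteSeries
open Polynomial

lemma hermite_differential_equation (n : ℕ) :
    derivative (derivative (hermite n)) - X * derivative (hermite n) + (n : ℤ[X]) * hermite n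
      = 0 := by
  induction n with
  | zero => simp
  | succ n ih =>
    have hderiv : derivative (hermite (n + 1)) = (n + 1 : ℤ[X]) * hermite n := by
      rw [hermite_succ, derivative_sub, derivative_mul, derivative_X]
      linear_combination -ih
    have hderiv2 : derivative (derivative (hermite (n + 1)))
        = (n + 1 : ℤ[X]) * derivative (hermite n) := by
      rw [hderiv, derivative_mul]
      simp
    rw [hderiv2, hderiv, hermite_succ]
    push_cast
    ring

lemma coeff_hermite_add_two (n j : ℕ) :
    ((j + 2 : ℤ) * (j + 1)) * (hermite n).coeff (j + 2) = (j - n) * (hermite n).coeff j := by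
  have hcoeff := congrArg (coeff · j) (hermite_differential_equation n)
  have hX : (X * derivative (hermite n)).coeff j = (hermite n).coeff j * j := by
    cases j with
    | zero => simp
    | succ j => rw [coeff_X_mul, coeff_derivative]; push_cast; ring
  simp only [coeff_add, coeff_sub, coeff_derivative, hX, coeff_natCast_mul, coeff_zero] at hcoeff
  push_cast at hcoeff
  linear_combination hcoeff

lemma factorial_mul_coeff_hermite (n : ℕ) {e : ℕ} (he : e ≤ 1) (k : ℕ) :
    ((2 * k + e).factorial : ℤ) * (hermite n).coeff (2 * k + e)
      = (∏ j ∈ Finset.range k, (-(n : ℤ) + e + 2 * j)) * (hermite n).coeff e := by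
  induction k with
  | zero => simp [Nat.factorial_eq_one.2 he]
  | succ k ih =>
    have hrec := coeff_hermite_add_two n (2 * k + e)
    rw [Finset.prod_range_succ, show 2 * (k + 1) + e = 2 * k + e + 2 by ring,
      Nat.factorial_succ, Nat.factorial_succ]
    push_cast at hrec ⊢
    linear_combination ((2 * k + e).factorial : ℤ) * hrec + (-(n : ℤ) + e + 2 * k) * ih

lemma aeval_hermite_eq_sum {n m e : ℕ} (he : e ≤ 1) (hn : n = 2 * m + e) (x : ℝ) :
    aeval x (hermite n)
      = ∑ k ∈ Finset.range (m + 1), ((hermite n).coeff (2 * k + e) : ℝ) * x ^ (2 * k + e) := by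
  have hinj : Set.InjOn (fun k => 2 * k + e) (Finset.range (m + 1)) := fun i _ j _ h => by
    simpa using h
  rw [aeval_eq_sum_range, natDegree_hermite, ← Finset.sum_image (s := Finset.range (m + 1))
    (f := fun j => ((hermite n).coeff j : ℝ) * x ^ j) hinj]
  simp only [zsmul_eq_mul]
  refine (Finset.sum_subset (fun j hj => ?_) fun j _ hj' => ?_).symm
  · simp only [Finset.mem_image, Finset.mem_range] at hj ⊢
    omega
  · rw [coeff_hermite_of_odd_add, Int.cast_zero, zero_mul]
    simp only [Finset.mem_image, Finset.mem_range, not_exists, not_and] at hj'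
    by_contra heven
    rw [Nat.not_odd_iff_even, Nat.even_iff] at heven
    exact hj' ((j - e) / 2) (by grind) (by grind)

lemma aeval_hermite_eq_tsum {n m e : ℕ} (he : e ≤ 1) (hn : n = 2 * m + e) (x : ℝ) :
    ((aeval x (hermite n) : ℝ) : ℂ) = ((hermite n).coeff e : ℂ) *
      ∑' k : ℕ, (∏ j ∈ Finset.range k, (-(n : ℂ) + e + 2 * (j : ℂ))) * (x : ℂ) ^ (2 * k + e) /
        (Nat.factorial (2 * k + e) : ℂ) := by
  have hprod : ∀ k ∉ Finset.range (m + 1),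
      ∏ j ∈ Finset.range k, (-(n : ℂ) + e + 2 * (j : ℂ)) = 0 := fun k hk =>
    Finset.prod_eq_zero (i := m) (Finset.mem_range.2 (by simpa using hk))
      (by rw [hn]; push_cast; ring)
  rw [tsum_eq_sum (s := Finset.range (m + 1)) fun k hk => by rw [hprod k hk]; simp,
    Finset.mul_sum, aeval_hermite_eq_sum he hn]
  push_cast
  refine Finset.sum_congr rfl fun k _ => ?_
  have hcoeff := congrArg (Int.cast : ℤ → ℂ) (factorial_mul_coeff_hermite n he k)
  push_cast at hcoeff
  have hfactorial : (Nat.factorial (2 * k + e) : ℂ) ≠ 0 := mod_cast Nat.factorial_ne_zero _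
  field_simp
  linear_combination (x : ℂ) ^ (2 * k + e) * hcoeff

lemma hermiteFun_eq_coeff_mul_weberEven (m : ℕ) (x : ℝ) :
    (hermiteFun (2 * m) x : ℂ)
      = ((hermite (2 * m)).coeff 0 : ℂ) * weberEven ((2 * m : ℕ) : ℂ) x := by
  rw [hermiteFun, Complex.ofReal_mul, aeval_hermite_eq_tsum zero_le_one (add_zero (2 * m)).symm,
    weberEven]
  push_cast
  simp only [add_zero]
  ring

lemma hermiteFun_eq_coeff_mul_weberOdd (m : ℕ) (x : ℝ) :
    (hermiteFun (2 * m + 1) x : ℂ)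
      = ((hermite (2 * m + 1)).coeff 1 : ℂ) * weberOdd ((2 * m + 1 : ℕ) : ℂ) x := by
  rw [hermiteFun, Complex.ofReal_mul, aeval_hermite_eq_tsum le_rfl rfl, weberOdd]
  push_cast
  ring

end HermiteSeries

lemma Gamma_half_sub_intCast_ne_zero (m : ℤ) : Complex.Gamma (1 / 2 - m) ≠ 0 := by
  refine Complex.Gamma_ne_zero fun k h => ?_
  have hcast : (1 : ℂ) = ((2 * (m - k) : ℤ) : ℂ) := by push_cast; linear_combination 2 * h
  have hint : (1 : ℤ) = 2 * (m - k) := by exact_mod_cast hcast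
  omega

lemma weberEven_eq_zero_of_parabolicCylinderD {m : ℕ} {x : ℂ}
    (h : parabolicCylinderD (2 * m : ℕ) x = 0) : weberEven (2 * m : ℕ) x = 0 := by
  have hpole : Complex.Gamma (-((2 * m : ℕ) : ℂ) / 2) = 0 := by
    rw [show -((2 * m : ℕ) : ℂ) / 2 = -(m : ℂ) by push_cast; ring]
    exact Complex.Gamma_neg_nat_eq_zero m
  have hΓ : Complex.Gamma (-((2 * m : ℕ) : ℂ) / 2 + 1 / 2) ≠ 0 := by
    rw [show -((2 * m : ℕ) : ℂ) / 2 + 1 / 2 = 1 / 2 - ((m : ℤ) : ℂ) by push_cast; ring]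
    exact Gamma_half_sub_intCast_ne_zero m
  rw [parabolicCylinderD, hpole, inv_zero, mul_zero, zero_mul, sub_zero] at h
  refine (mul_eq_zero.1 h).resolve_left ?_
  exact mul_ne_zero (mul_ne_zero (by simp)
    (Complex.ofReal_ne_zero.2 (Real.sqrt_pos.2 Real.pi_pos).ne')) (inv_ne_zero hΓ)

lemma weberOdd_eq_zero_of_parabolicCylinderD {m : ℕ} {x : ℂ}
    (h : parabolicCylinderD (2 * m + 1 : ℕ) x = 0) : weberOdd (2 * m + 1 : ℕ) x = 0 := by
  have hpole : Complex.Gamma (-((2 * m + 1 : ℕ) : ℂ) / 2 + 1 / 2) = 0 := by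
    rw [show -((2 * m + 1 : ℕ) : ℂ) / 2 + 1 / 2 = -(m : ℂ) by push_cast; ring]
    exact Complex.Gamma_neg_nat_eq_zero m
  have hΓ : Complex.Gamma (-((2 * m + 1 : ℕ) : ℂ) / 2) ≠ 0 := by
    rw [show -((2 * m + 1 : ℕ) : ℂ) / 2 = 1 / 2 - ((m + 1 : ℤ) : ℂ) by push_cast; ring]
    exact Gamma_half_sub_intCast_ne_zero (m + 1)
  rw [parabolicCylinderD, hpole, inv_zero, mul_zero, zero_mul, zero_sub, neg_eq_zero] at h
  refine (mul_eq_zero.1 h).resolve_left ?_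
  exact mul_ne_zero (mul_ne_zero (by simp [Complex.cpow_eq_zero_iff])
    (Complex.ofReal_ne_zero.2 (Real.sqrt_pos.2 Real.pi_pos).ne')) (inv_ne_zero hΓ)

lemma hermiteFun_eq_zero_of_parabolicCylinderD {n : ℕ} {x : ℝ}
    (h : parabolicCylinderD n x = 0) : hermiteFun n x = 0 := by
  rw [← Complex.ofReal_eq_zero]
  obtain ⟨m, rfl | rfl⟩ := n.even_or_odd'
  · rw [hermiteFun_eq_coeff_mul_weberEven, weberEven_eq_zero_of_parabolicCylinderD h, mul_zero]
  · rw [hermiteFun_eq_coeff_mul_weberOdd, weberOdd_eq_zero_of_parabolicCylinderD h, mul_zero]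

end

theorem mainTheorem9 (b : ℝ) (hb : 0 < b) (n : ℕ)
    (hn : parabolicCylinderD (n : ℂ) (b : ℂ) = 0) (ρ : ℝ) (hρ : 0 < ρ) :
    ∃ δ : ℝ, 0 < δ ∧ ∀ r : ℝ, 1 / δ < r →
      ∃ ν₁ ν₂ : ℂ, ν₁ ≠ ν₂ ∧ ν₁.im ≠ 0 ∧ ν₂.im ≠ 0 ∧
        IsEigenvalue (pcOperator (Complex.I * (r : ℂ)) b) ν₁ ∧
        IsEigenvalue (pcOperator (Complex.I * (r : ℂ)) b) ν₂ ∧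
        ‖ν₁ - (n : ℂ)‖ < ρ ∧ ‖ν₂ - (n : ℂ)‖ < ρ := by
  obtain ⟨R, hR⟩ := Filter.eventually_atTop.1
    (eventually_exists_nonreal_eigenvalues hb (hermiteFun_eq_zero_of_parabolicCylinderD hn) hρ)
  refine ⟨1 / max R 1, by positivity, fun r hr => ?_⟩
  rw [one_div_one_div] at hr
  obtain ⟨ν₁, ν₂, him₁, him₂, ⟨hρ₁, hν₁⟩, hρ₂, hν₂⟩ := hR r ((le_max_left R 1).trans hr.le)
  refine ⟨ν₁, ν₂, ?_, him₁.ne', him₂.ne, hν₁, hν₂, hρ₁, hρ₂⟩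
  rintro rfl
  exact him₁.not_gt him₂
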